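/- Let $X\subset\mathbb R^m$ be compact and convex, let $x_1,\dots,x_k\in X$ ($k\ge 1$) be distinct points (factories), let $\mathbf b=\sum_{j=1}^{\ell}n_j\delta_{y_j}$ be an atomic probability measure on $X$ ($y_j\in X$, $n_j>0$, $\sum_j n_j=1$; households), and let $\alpha\in[0,1)$. Definitions. For atomic measures $\mathbf a,\mathbf c$ on $X$ (finite nonnegative combinations of Dirac masses), a transport path $G\in Path(\mathbf a,\mathbf c)$ is a finite weighted directed graph with vertex set $V(G)\subset X$ containing the supports of $\mathbf a$ and $\mathbf c$, whose edges $e$ are directed segments between vertices with weights $w(e)>0$, which has no cycles (regardless of the directions of edges), and which satisfies, at each vertex $v$, $$\sum_{e^-=v}w(e)=\sum_{e^+=v}w(e)+\mathbf a(\{v\})-\mathbf c(\{v\}),$$ where $e^-$ and $e^+$ are the starting and ending points of $e$. Its cost is $\mathbf M_\alpha(G)=\sum_e w(e)^\alpha\,\mathrm{length}(e)$; $d_\alpha(\mathbf a,\mathbf c)$ is the minimal cost over $Path(\mathbf a,\mathbf c)$, and $G$ is an optimal transport path if it has minimal cost in $Path(\mathbf a,\mathbf c)$. Sums of graphs are formed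 by uniting vertex sets and adding weights. - An allocation plan $q\in Plan[\mathbf x,\mathbf b]$ is a matrix $q_{ij}\ge 0$ ($1\le i\le k$, $1\le j\le\ell$) with $\sum_i q_{ij}=n_j$ for all $j$ (that is, the measure $\sum_{i,j} q_{ij}\delta_{(x_i,y_j)}$). Put $\mathbf a(q)=\sum_i\big(\sum_j q_{ij}\big)\delta_{x_i}$. A path $G$ is compatible with $q$ if, $g_{ij}$ denoting the directed curve on $G$ from $x_i$ to $y_j$ (empty if there is none; a single point if $x_i=y_j\in V(G)$), one has $q_{ij}=0$ whenever $g_{ij}$ is empty, and $G=\sum_{i,j}q_{ij}\,g_{ij}$, i.e. $w(e)=\sum_{i,j:\,e\in g_{ij}}q_{ij}$ for every edge $e$. The cost $\mathbf T_\alpha(q)$ is the least (infimum) value of $\mathbf M_\alpha(G)$ over the $G\in Path(\mathbf a(q),\mathbf b)$ compatible with $q$ ($+\infty$ if there is none). A plan is optimal if it minimizes $\mathbf T_\alpha$ over $Plan[\mathbf x,\mathbf b]$. - An allocation path $G\in Path[\mathbf x,\mathbf b]$ is an element of $Path(\mathbf a,\mathbf b)$ for some atomic probability measure $\mathbf a$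 supported on $\{x_1,\dots,x_k\}$. It is optimal if it minimizes $\mathbf M_\alpha$ over $Path[\mathbf x,\mathbf b]$. - An assignment map is a function $S:\{1,\dots,\ell\}\to\{1,\dots,k\}$. Put $\mathbf a_i=\big(\sum_{S(j)=i}n_j\big)\delta_{x_i}$, $\mathbf b_i=\sum_{S(j)=i}n_j\delta_{y_j}$ and $\mathbf E_\alpha(S)=\sum_{i=1}^k d_\alpha(\mathbf a_i,\mathbf b_i)$. The map $S$ is optimal if it minimizes $\mathbf E_\alpha$ over all assignment maps. Its plan $q_S$ has $q_{ij}=n_j$ if $i=S(j)$ and $q_{ij}=0$ otherwise. Theorem. 1. An allocation plan $q\in Plan[\mathbf x,\mathbf b]$ is optimal if and only if $q=q_S$ for some optimal assignment map $S$. 2. An allocation path $G\in Path[\mathbf x,\mathbf b]$ is optimal if and only if there are an optimal assignment map $S$ and optimal transport paths $G_i\in Path(\mathbf a_i,\mathbf b_i)$, $i=1,\dots,k$, for this $S$ such that $G=\sum_{i=1}^k G_i$. 3. The three minima below exist, are finite and are equal: $$\min_{q\in Plan[\mathbf x,\mathbf b]}\mathbf T_\alpha(q)=\min_{S}\mathbf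 E_\alpha(S)=\min_{G\in Path[\mathbf x,\mathbf b]}\mathbf M_\alpha(G).$$ -/

import Mathlib

open scoped NNReal ENNReal

namespace RamifiedAllocation

/-- An atomic (nonnegative) measure: a finite combination of Dirac masses, given by the mass of
each point. `Finsupp.single z c` stands for `c δ_z`. -/
abbrev AtomicMeasure (E : Type*) := E →₀ ℝ≥0

/-- A finite weighted directed graph drawn in `E`: a finite set of points as vertices, and a
weight on pairs of points. The pair `(u, v)` is the directed segment from `u` to `v`; the edges
are the pairs of non-zero, hence positive, weight. -/
@[ext]
structure WeightedGraph (E : Type*) where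
  verts : Finset E
  weight : E × E →₀ ℝ≥0
  mem_verts : ∀ e ∈ weight.support, e.1 ∈ verts ∧ e.2 ∈ verts

namespace WeightedGraph

/-- The edge set. -/
def edges {E : Type*} (G : WeightedGraph E) : Finset (E × E) := G.weight.support

open Classical in
/-- Total weight of the edges starting at `v`. -/
noncomputable def outflow {E : Type*} (G : WeightedGraph E) (v : E) : ℝ≥0 :=
  ∑ e ∈ G.edges with e.1 = v, G.weight e

open Classical in
/-- Total weight of the edges ending at `v`. -/
noncomputable def inflow {E : Type*} (G : WeightedGraph E) (v : E) : ℝ≥0 :=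
  ∑ e ∈ G.edges with e.2 = v, G.weight e

/-- The graph contains no cycles, whatever the directions of the edges: no loop, no pair of
opposite edges, and no cycle of length at least three in the underlying undirected graph. -/
def NoCycles {E : Type*} (G : WeightedGraph E) : Prop :=
  (∀ u v, (u, v) ∈ G.edges → (v, u) ∉ G.edges) ∧
    (SimpleGraph.fromRel fun u v => (u, v) ∈ G.edges).IsAcyclic

/-- The `M_α` cost `∑ w(e)^α length(e)`. -/
noncomputable def cost {E : Type*} [MetricSpace E] (α : ℝ) (G : WeightedGraph E) : ℝ≥0 :=
  ∑ e ∈ G.edges, G.weight e ^ α * nndist e.1 e.2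

open Classical in
/-- The sum of finitely many weighted graphs: union of the vertex sets, weights added. -/
noncomputable def sum {E ι : Type*} [Fintype ι] (G : ι → WeightedGraph E) : WeightedGraph E where
  verts := Finset.univ.biUnion fun i => (G i).verts
  weight := ∑ i, (G i).weight
  mem_verts := by
    intro e he
    rw [Finsupp.mem_support_iff, Finsupp.finsetSum_apply] at he
    obtain ⟨i, hi, hne⟩ := Finset.exists_ne_zero_of_sum_ne_zero he
    have h := (G i).mem_verts e (Finsupp.mem_support_iff.2 hne)
    exact ⟨Finset.mem_biUnion.2 ⟨i, hi, h.1⟩, Finset.mem_biUnion.2 ⟨i, hi, h.2⟩⟩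

/-- `p` is the list of vertices of a directed polyhedral curve on `G` from `u` to `v`: distinct
vertices, consecutive ones joined by an edge of `G`. For `u = v` the one-vertex list is such a
curve. -/
def IsCurve {E : Type*} (G : WeightedGraph E) (u v : E) (p : List E) : Prop :=
  p.head? = some u ∧ p.getLast? = some v ∧ p.Nodup ∧ (∀ z ∈ p, z ∈ G.verts) ∧
    p.IsChain fun a b => (a, b) ∈ G.edges

/-- `p` is a directed curve on `G` from `u` to `v` if there is one, and the empty curve `[]`
otherwise. -/
def IsCurveOrEmpty {E : Type*} (G : WeightedGraph E) (u v : E) (p : List E) : Prop :=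
  G.IsCurve u v p ∨ (p = [] ∧ ¬ ∃ p', G.IsCurve u v p')

end WeightedGraph

open Classical in
/-- The chain of a curve: coefficient one on each of its edges. -/
noncomputable def curveChain {E : Type*} (p : List E) : E × E →₀ ℝ≥0 :=
  ∑ e ∈ (p.zip p.tail).toFinset, Finsupp.single e 1

/-- `G ∈ Path(a, b)`: `G` is a transport path in `X` from `a` to `b`. The balance equation is
`outflow = inflow + a - b` at each vertex, written without subtraction. -/
structure IsTransportPath {E : Type*} (X : Set E) (a b : AtomicMeasure E)
    (G : WeightedGraph E) : Prop where
  verts_subset : ∀ v ∈ G.verts, v ∈ X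
  source_mem : ∀ v ∈ a.support, v ∈ G.verts
  target_mem : ∀ v ∈ b.support, v ∈ G.verts
  balance : ∀ v ∈ G.verts, G.outflow v + b v = G.inflow v + a v
  noCycles : G.NoCycles

/-- `d_α(a, b)`, the minimal `M_α` cost of a transport path in `X` from `a` to `b`. -/
noncomputable def dAlpha {E : Type*} [MetricSpace E] (X : Set E) (α : ℝ)
    (a b : AtomicMeasure E) : ℝ≥0∞ :=
  ⨅ G ∈ {G : WeightedGraph E | IsTransportPath X a b G}, (G.cost α : ℝ≥0∞)

/-- `G` is an optimal transport path from `a` to `b`. -/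
def IsOptimalTransportPath {E : Type*} [MetricSpace E] (X : Set E) (α : ℝ)
    (a b : AtomicMeasure E) (G : WeightedGraph E) : Prop :=
  IsTransportPath X a b G ∧ ∀ G', IsTransportPath X a b G' → G.cost α ≤ G'.cost α

/-- The atomic measure `∑ c_i δ_{z_i}`. -/
noncomputable def atomic {E ι : Type*} [Fintype ι] (z : ι → E) (c : ι → ℝ≥0) :
    AtomicMeasure E :=
  ∑ i, Finsupp.single (z i) (c i)

/-- `Plan[x, b]`, for households with demands `n`. A plan is given by its coefficients:
`q i j` is the amount that household `j` receives from factory `i`. -/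
def AllocPlan {k l : ℕ} (n : Fin l → ℝ≥0) : Set (Fin k → Fin l → ℝ≥0) :=
  {q | ∀ j, ∑ i, q i j = n j}

/-- The production `m_i(q)` of factory `i` under the plan `q`. -/
noncomputable def production {k l : ℕ} (q : Fin k → Fin l → ℝ≥0) (i : Fin k) : ℝ≥0 := ∑ j, q i j

/-- The pair `(G, q)` is compatible: `G = q · g`, where `g i j` is the curve on `G` from `x i` to
`y j` (empty if there is none), and `q i j = 0` whenever `g i j` is empty. -/
def Compatible {E : Type*} {k l : ℕ} (x : Fin k → E) (y : Fin l → E) (G : WeightedGraph E)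
    (q : Fin k → Fin l → ℝ≥0) : Prop :=
  ∃ g : Fin k → Fin l → List E,
    (∀ i j, G.IsCurveOrEmpty (x i) (y j) (g i j)) ∧
    (∀ i j, g i j = [] → q i j = 0) ∧
    G.weight = ∑ i, ∑ j, q i j • curveChain (g i j)

/-- The ramified transportation cost `T_α(q)`: the least cost of a path in `Path(a(q), b)` that is
compatible with `q` (infinite if there is no such path). -/
noncomputable def planCost {E : Type*} [MetricSpace E] (X : Set E) (α : ℝ) {k l : ℕ}
    (x : Fin k → E) (y : Fin l → E) (n : Fin l → ℝ≥0) (q : Fin k → Fin l → ℝ≥0) : ℝ≥0∞ :=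
  ⨅ G ∈ {G : WeightedGraph E |
      IsTransportPath X (atomic x (production q)) (atomic y n) G ∧ Compatible x y G q},
    (G.cost α : ℝ≥0∞)

/-- `q` is an optimal allocation plan. -/
def IsOptimalPlan {E : Type*} [MetricSpace E] (X : Set E) (α : ℝ) {k l : ℕ}
    (x : Fin k → E) (y : Fin l → E) (n : Fin l → ℝ≥0) (q : Fin k → Fin l → ℝ≥0) : Prop :=
  q ∈ AllocPlan n ∧ ∀ q' ∈ AllocPlan (k := k) n, planCost X α x y n q ≤ planCost X α x y n q'

/-- `Path[x, b]` with `b = ∑ n_j δ_{y_j}`: transport paths to `b` from some probability measure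
supported on the factory locations. -/
def AllocPath {E : Type*} (X : Set E) {k l : ℕ} (x : Fin k → E) (y : Fin l → E)
    (n : Fin l → ℝ≥0) : Set (WeightedGraph E) :=
  {G | ∃ m : Fin k → ℝ≥0, ∑ i, m i = 1 ∧ IsTransportPath X (atomic x m) (atomic y n) G}

/-- `G` is an optimal allocation path. -/
def IsOptimalPath {E : Type*} [MetricSpace E] (X : Set E) (α : ℝ) {k l : ℕ}
    (x : Fin k → E) (y : Fin l → E) (n : Fin l → ℝ≥0) (G : WeightedGraph E) : Prop :=
  G ∈ AllocPath X x y n ∧ ∀ G' ∈ AllocPath X x y n, G.cost α ≤ G'.cost α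

/-- The allocation plan `q_S` of an assignment map `S`: household `j` is served by factory `S j`
only. -/
def planOfMap {k l : ℕ} (n : Fin l → ℝ≥0) (S : Fin l → Fin k) : Fin k → Fin l → ℝ≥0 :=
  fun i j => if i = S j then n j else 0

/-- `a_i = (∑_{S j = i} n_j) δ_{x_i}`. -/
noncomputable def sourcePart {E : Type*} {k l : ℕ} (x : Fin k → E) (n : Fin l → ℝ≥0)
    (S : Fin l → Fin k) (i : Fin k) : AtomicMeasure E :=
  Finsupp.single (x i) (∑ j with S j = i, n j)

/-- `b_i = ∑_{S j = i} n_j δ_{y_j}`. -/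
noncomputable def targetPart {E : Type*} {k l : ℕ} (y : Fin l → E) (n : Fin l → ℝ≥0)
    (S : Fin l → Fin k) (i : Fin k) : AtomicMeasure E :=
  ∑ j with S j = i, Finsupp.single (y j) (n j)

/-- `E_α(S; x, b) = ∑_i d_α(a_i, b_i)`. -/
noncomputable def mapCost {E : Type*} [MetricSpace E] (X : Set E) (α : ℝ) {k l : ℕ}
    (x : Fin k → E) (y : Fin l → E) (n : Fin l → ℝ≥0) (S : Fin l → Fin k) : ℝ≥0∞ :=
  ∑ i, dAlpha X α (sourcePart x n S i) (targetPart y n S i)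

/-- `S` is an optimal assignment map. -/
def IsOptimalMap {E : Type*} [MetricSpace E] (X : Set E) (α : ℝ) {k l : ℕ}
    (x : Fin k → E) (y : Fin l → E) (n : Fin l → ℝ≥0) (S : Fin l → Fin k) : Prop :=
  ∀ S' : Fin l → Fin k, mapCost X α x y n S ≤ mapCost X α x y n S'

/-- `G` is one of the paths `G_S = ∑_i G_i`, where each `G_i` is an optimal transport path from
`a_i` to `b_i`. -/
def IsPathOfMap {E : Type*} [MetricSpace E] (X : Set E) (α : ℝ) {k l : ℕ}
    (x : Fin k → E) (y : Fin l → E) (n : Fin l → ℝ≥0) (S : Fin l → Fin k)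
    (G : WeightedGraph E) : Prop :=
  ∃ Gs : Fin k → WeightedGraph E,
    (∀ i, IsOptimalTransportPath X α (sourcePart x n S i) (targetPart y n S i) (Gs i)) ∧
    G = WeightedGraph.sum Gs

end RamifiedAllocation

open RamifiedAllocation

/-!
The proof regards every graph as a chain `W` with real coefficients on pairs of points, and a
transport path to `b` from the factories as a *flow* (`IsFlow`): `W ≥ 0`, and `div W + b` is
nonnegative and supported at the factories `x i`.

The heart of the matter is strict concavity. Suppose that the support of a flow carries a nonzero
chain `σ` whose divergence is supported at the factories, which is the case exactly when the
support contains a cycle or connects two factories. If nothing flows into a factory, then all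
`W + t • σ` with nonnegative coefficients are flows. The cost is concave in `t`, and at each end of
the interval of admissible `t` an edge of positive length disappears, which gives a strict gain even
for `α = 0`. (If `σ` has one sign, there is only one end, and the cost decreases towards it.) Inflow
at factories can be cancelled beforehand, also with a strict gain. Therefore a flow of minimal cost
is reduced (`IsFlow.exists_lt_of_not_isReduced`): its support is *rigid*, that is, a forest in which
different factories lie in different components. A flow with rigid support is determined by its
divergence off the factories, so it is the superposition of one curve for each household
(`IsFlow.exists_curves`); this yields the assignment map `S`, and the decomposition of the flow into
edge-disjoint pieces for the single factories (`exists_split`).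

Minima exist by compactness (`exists_optimal_routing`). In a forest, nonterminal vertices of degree
two can be bypassed, after which the number of vertices is bounded. So only finitely many abstract
graphs occur, and for each of them the cost is a continuous function of the positions of the
vertices in `X`. The same statement, applied to an arbitrary fixed plan `q`, handles the infimum in
`planCost`: it provides a flow that carries `q` at cost at most `planCost q`. If `q` is optimal,
this flow is minimal, hence rigid, and a household served by two factories would connect these.

All three costs are finally compared with the cost `c` of one minimal flow.
-/

namespace RamifiedAllocation

/-! ### The cost of a mass -/

section MassCost

/-- The cost per unit length of a mass `c`: it is `c ^ α` for `c ≠ 0`, and `0` for `c = 0` even when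
`α = 0`, where `0 ^ 0 = 1` would charge for unused edges. -/
noncomputable def massCost (α c : ℝ) : ℝ := if c = 0 then 0 else c ^ α

@[simp] lemma massCost_zero (α : ℝ) : massCost α 0 = 0 := by simp [massCost]

lemma massCost_of_ne {α c : ℝ} (h : c ≠ 0) : massCost α c = c ^ α := by simp [massCost, h]

lemma massCost_nonneg {α c : ℝ} (hc : 0 ≤ c) : 0 ≤ massCost α c := by
  unfold massCost; split_ifs
  · exact le_rfl
  · positivity

lemma massCost_pos {α c : ℝ} (hc : 0 < c) : 0 < massCost α c := by
  rw [massCost_of_ne hc.ne']; positivity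

lemma massCost_mono {α a b : ℝ} (hα : 0 ≤ α) (ha : 0 ≤ a) (hab : a ≤ b) :
    massCost α a ≤ massCost α b := by
  rcases ha.eq_or_lt with rfl | ha
  · simpa using massCost_nonneg hab
  · rw [massCost_of_ne ha.ne', massCost_of_ne (ha.trans_le hab).ne']
    exact Real.rpow_le_rpow ha.le hab hα

lemma massCost_add_le {α a b : ℝ} (hα : 0 ≤ α) (hα1 : α < 1) (ha : 0 ≤ a) (hb : 0 ≤ b) :
    massCost α (a + b) ≤ massCost α a + massCost α b := by
  rcases ha.eq_or_lt with rfl | ha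
  · simp
  rcases hb.eq_or_lt with rfl | hb
  · simp
  rw [massCost_of_ne ha.ne', massCost_of_ne hb.ne', massCost_of_ne (by positivity)]
  exact Real.rpow_add_le_add_rpow ha.le hb.le hα hα1.le

lemma massCost_sum_le {α : ℝ} (hα : 0 ≤ α) (hα1 : α < 1) {ι : Type*} (s : Finset ι) (g : ι → ℝ)
    (hg : ∀ i, 0 ≤ g i) : massCost α (∑ i ∈ s, g i) ≤ ∑ i ∈ s, massCost α (g i) :=
  Finset.le_sum_of_subadditive_on_pred (massCost α) (fun c => 0 ≤ c) (by simp)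
    (fun _ _ ha hb => massCost_add_le hα hα1 ha hb) (fun _ _ => add_nonneg) g fun i _ => hg i

/-- Scaling a positive mass down by a factor `s < 1` saves strictly less than the factor `s`; this
is the only strictness available when `α = 0`. -/
lemma mul_massCost_lt {α w s : ℝ} (hα1 : α < 1) (hw : 0 < w) (hs : 0 < s) (hs1 : s < 1) :
    s * massCost α w < massCost α (s * w) := by
  rw [massCost_of_ne hw.ne', massCost_of_ne (by positivity), Real.mul_rpow hs.le hw.le]
  refine mul_lt_mul_of_pos_right ?_ (by positivity)
  simpa using Real.rpow_lt_rpow_of_exponent_gt hs hs1 hα1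

lemma mul_massCost_le {α w s : ℝ} (hα1 : α < 1) (hw : 0 ≤ w) (hs : 0 < s) (hs1 : s < 1) :
    s * massCost α w ≤ massCost α (s * w) := by
  rcases hw.eq_or_lt with rfl | hw
  · simp
  · exact (mul_massCost_lt hα1 hw hs hs1).le

lemma massCost_concave {α a b s t : ℝ} (hα : 0 ≤ α) (hα1 : α < 1) (ha : 0 ≤ a) (hb : 0 ≤ b)
    (hs : 0 < s) (ht : 0 < t) (hst : s + t = 1) :
    s * massCost α a + t * massCost α b ≤ massCost α (s * a + t * b) := by
  rcases ha.eq_or_lt with rfl | ha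
  · simpa using mul_massCost_le hα1 hb ht (by linarith)
  rcases hb.eq_or_lt with rfl | hb
  · simpa using mul_massCost_le hα1 ha.le hs (by linarith)
  rw [massCost_of_ne ha.ne', massCost_of_ne hb.ne', massCost_of_ne (by positivity)]
  exact (Real.concaveOn_rpow hα hα1.le).2 ha.le hb.le hs.le ht.le hst

end MassCost

/-! ### The cost of a chain -/

section ChainCost

variable {V U : Type*}

/-- The `M_α` cost of a chain with real coefficients. The length function is a parameter, so that
abstract graphs drawn at variable positions are covered. -/
noncomputable def chainCost (α : ℝ) (len : V × V → ℝ) (W : V × V →₀ ℝ) : ℝ :=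
  W.sum fun e c => massCost α c * len e

lemma chainCost_eq_sum {α : ℝ} {len : V × V → ℝ} {W : V × V →₀ ℝ} {s : Finset (V × V)}
    (h : W.support ⊆ s) : chainCost α len W = ∑ e ∈ s, massCost α (W e) * len e :=
  Finsupp.sum_of_support_subset _ h _ (by simp)

lemma chainCost_nonneg {α : ℝ} {len : V × V → ℝ} (hlen : ∀ e, 0 ≤ len e) {W : V × V →₀ ℝ}
    (hW : 0 ≤ W) : 0 ≤ chainCost α len W :=
  Finset.sum_nonneg fun e _ => mul_nonneg (massCost_nonneg (hW e)) (hlen e)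

open Classical in
lemma chainCost_lt {α : ℝ} (hα : 0 ≤ α) {len : V × V → ℝ} (hlen : ∀ e, 0 ≤ len e)
    {W W' : V × V →₀ ℝ} (hW : 0 ≤ W) (hle : W ≤ W') {e : V × V} (he : W e = 0) (he' : 0 < W' e)
    (hpos : 0 < len e) : chainCost α len W < chainCost α len W' := by
  rw [chainCost_eq_sum (s := W.support ∪ W'.support) Finset.subset_union_left,
    chainCost_eq_sum (s := W.support ∪ W'.support) Finset.subset_union_right]
  refine Finset.sum_lt_sum (fun e _ =>
    mul_le_mul_of_nonneg_right (massCost_mono hα (hW e) (hle e)) (hlen e)) ⟨e, ?_, ?_⟩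
  · exact Finset.mem_union_right _ (by simpa using he'.ne')
  · rw [he]; simpa using mul_pos (massCost_pos he') hpos

open Classical in
lemma chainCost_add_le {α : ℝ} (hα : 0 ≤ α) (hα1 : α < 1) {len : V × V → ℝ}
    (hlen : ∀ e, 0 ≤ len e) {W W' : V × V →₀ ℝ} (hW : 0 ≤ W) (hW' : 0 ≤ W') :
    chainCost α len (W + W') ≤ chainCost α len W + chainCost α len W' := by
  rw [chainCost_eq_sum (s := W.support ∪ W'.support) Finset.subset_union_left,
    chainCost_eq_sum (s := W.support ∪ W'.support) Finset.subset_union_right,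
    chainCost_eq_sum Finsupp.support_add, ← Finset.sum_add_distrib]
  refine Finset.sum_le_sum fun e _ => ?_
  rw [← add_mul]
  exact mul_le_mul_of_nonneg_right (massCost_add_le hα hα1 (hW e) (hW' e)) (hlen e)

lemma chainCost_sum_le {α : ℝ} (hα : 0 ≤ α) (hα1 : α < 1) {len : V × V → ℝ}
    (hlen : ∀ e, 0 ≤ len e) {ι : Type*} (s : Finset ι) (W : ι → V × V →₀ ℝ) (hW : ∀ i, 0 ≤ W i) :
    chainCost α len (∑ i ∈ s, W i) ≤ ∑ i ∈ s, chainCost α len (W i) :=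
  Finset.le_sum_of_subadditive_on_pred (chainCost α len) (fun c => 0 ≤ c) (by simp [chainCost])
    (fun _ _ ha hb => chainCost_add_le hα hα1 hlen ha hb) (fun _ _ => add_nonneg) W fun i _ => hW i

/-- A proper convex combination costs strictly more than the same combination of costs, as soon as
one of the two chains misses an edge of positive length that the other one uses. -/
lemma chainCost_concave_lt {α : ℝ} (hα : 0 ≤ α) (hα1 : α < 1) {len : V × V → ℝ}
    (hlen : ∀ e, 0 ≤ len e) {A B : V × V →₀ ℝ} (hA : 0 ≤ A) (hB : 0 ≤ B) {s t : ℝ}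
    (hs : 0 < s) (ht : 0 < t) (hst : s + t = 1) {e : V × V} (he : A e = 0) (he' : 0 < B e)
    (hpos : 0 < len e) :
    s * chainCost α len A + t * chainCost α len B < chainCost α len (s • A + t • B) := by
  classical
  have hAB : (s • A + t • B).support ⊆ A.support ∪ B.support :=
    Finsupp.support_add.trans
      (Finset.union_subset_union Finsupp.support_smul Finsupp.support_smul)
  rw [chainCost_eq_sum (s := A.support ∪ B.support) Finset.subset_union_left,
    chainCost_eq_sum (s := A.support ∪ B.support) Finset.subset_union_right,
    chainCost_eq_sum hAB, Finset.mul_sum, Finset.mul_sum, ← Finset.sum_add_distrib]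
  refine Finset.sum_lt_sum (fun e _ => ?_) ⟨e, ?_, ?_⟩
  · rw [← mul_assoc, ← mul_assoc, ← add_mul]
    exact mul_le_mul_of_nonneg_right (massCost_concave hα hα1 (hA e) (hB e) hs ht hst) (hlen e)
  · exact Finset.mem_union_right _ (by simpa using he'.ne')
  · have := mul_lt_mul_of_pos_right (mul_massCost_lt hα1 he' ht (by linarith)) hpos
    simpa [he, mul_assoc] using this

lemma chainCost_filter_le {α : ℝ} {len : V × V → ℝ} (hlen : ∀ e, 0 ≤ len e)
    {W : V × V →₀ ℝ} (hW : 0 ≤ W) (p : V × V → Prop) [DecidablePred p] :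
    chainCost α len (W.filter p) ≤ chainCost α len W := by
  rw [chainCost_eq_sum (s := W.support) (by simp [Finsupp.support_filter]),
    chainCost_eq_sum (s := W.support) subset_rfl]
  refine Finset.sum_le_sum fun e _ => ?_
  by_cases h : p e
  · simp [h]
  · simpa [h] using mul_nonneg (massCost_nonneg (hW e)) (hlen e)

lemma mapDomain_nonneg {A B : Type*} (φ : A → B) {W : A →₀ ℝ} (hW : 0 ≤ W) :
    0 ≤ W.mapDomain φ := by
  classical
  intro b
  rw [Finsupp.mapDomain, Finsupp.sum_apply]
  refine Finset.sum_nonneg fun a _ => ?_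
  simp only [Finsupp.single_apply]; split_ifs
  · exact hW a
  · exact le_rfl

/-- Identifying edges of equal length does not raise the cost, since the cost of a mass is
subadditive. -/
lemma chainCost_mapDomain_le {α : ℝ} (hα : 0 ≤ α) (hα1 : α < 1) {len : U × U → ℝ}
    (hlen : ∀ e, 0 ≤ len e) {W : V × V →₀ ℝ} (hW : 0 ≤ W) (Φ : V × V → U × U) :
    chainCost α len (W.mapDomain Φ) ≤ chainCost α (len ∘ Φ) W := by
  classical
  have h : ∀ e', W.mapDomain Φ e' = ∑ e ∈ W.support with Φ e = e', W e := by
    intro e'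
    rw [Finsupp.mapDomain, Finsupp.sum_apply, Finsupp.sum, Finset.sum_filter]
    simp [Finsupp.single_apply]
  rw [chainCost_eq_sum (s := W.support.image Φ) Finsupp.mapDomain_support,
    chainCost_eq_sum (s := W.support) subset_rfl,
    ← Finset.sum_fiberwise_of_maps_to (t := W.support.image Φ) (g := Φ)
      fun e he => Finset.mem_image_of_mem _ he]
  refine Finset.sum_le_sum fun e' _ => ?_
  rw [h]
  refine (mul_le_mul_of_nonneg_right (massCost_sum_le hα hα1 _ _ hW) (hlen e')).trans ?_
  rw [Finset.sum_mul]
  refine Finset.sum_le_sum fun e he => ?_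
  rw [Function.comp_apply, (Finset.mem_filter.1 he).2]

end ChainCost

/-! ### The divergence of a chain -/

section Divergence

variable {V U : Type*}

/-- The divergence of a chain: outflow minus inflow at each vertex. -/
noncomputable def div : (V × V →₀ ℝ) →ₗ[ℝ] (V →₀ ℝ) :=
  Finsupp.lmapDomain ℝ ℝ Prod.fst - Finsupp.lmapDomain ℝ ℝ Prod.snd

lemma div_def (d : V × V →₀ ℝ) : div d = d.mapDomain Prod.fst - d.mapDomain Prod.snd := rfl

@[simp] lemma div_single (e : V × V) (c : ℝ) :
    div (Finsupp.single e c) = Finsupp.single e.1 c - Finsupp.single e.2 c := by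
  simp [div_def, Finsupp.mapDomain_single]

lemma div_mapDomain (φ : V → U) (d : V × V →₀ ℝ) :
    div (d.mapDomain (Prod.map φ φ)) = (div d).mapDomain φ := by
  induction d using Finsupp.induction_linear with
  | zero => simp
  | add f g hf hg => simp [Finsupp.mapDomain_add, hf, hg]
  | single e c =>
    have := Finsupp.mapDomain_sub (f := φ) (v₁ := Finsupp.single e.1 c)
      (v₂ := Finsupp.single e.2 c)
    simp [Finsupp.mapDomain_single, this]

lemma mapDomain_apply_eq_sum {A B : Type*} [DecidableEq B] (φ : A → B) (d : A →₀ ℝ) (b : B) :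
    d.mapDomain φ b = ∑ a ∈ d.support with φ a = b, d a := by
  classical
  rw [Finsupp.mapDomain, Finsupp.sum_apply, Finsupp.sum, Finset.sum_filter]
  simp [Finsupp.single_apply]

open Classical in
lemma div_apply (d : V × V →₀ ℝ) (v : V) :
    div d v = ∑ e ∈ d.support with e.1 = v, d e - ∑ e ∈ d.support with e.2 = v, d e := by
  rw [div_def, Finsupp.sub_apply, mapDomain_apply_eq_sum, mapDomain_apply_eq_sum]

/-- Discrete divergence theorem: testing the divergence against a potential `h`. -/
lemma linearCombination_div (h : V → ℝ) (d : V × V →₀ ℝ) :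
    Finsupp.linearCombination ℝ h (div d) = d.sum fun e c => c * (h e.1 - h e.2) := by
  induction d using Finsupp.induction_linear with
  | zero => simp
  | add f g hf hg =>
    rw [map_add, map_add, hf, hg, Finsupp.sum_add_index']
    · simp
    · intros; ring
  | single e c => simp [mul_sub]

lemma div_filter_offDiag (d : V × V →₀ ℝ) [DecidablePred fun e : V × V => e.1 ≠ e.2] :
    div (d.filter fun e => e.1 ≠ e.2) = div d := by
  induction d using Finsupp.induction_linear with
  | zero => rw [Finsupp.filter_zero]
  | add f g hf hg => rw [Finsupp.filter_add, map_add, map_add, hf, hg]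
  | single e c =>
    by_cases h : e.1 = e.2
    · rw [Finsupp.filter_single_of_neg (p := fun e : V × V => e.1 ≠ e.2) (by simpa using h),
        div_single, h]
      simp
    · rw [Finsupp.filter_single_of_pos (p := fun e : V × V => e.1 ≠ e.2) h]

end Divergence

/-! ### Forests as edge sets without circulations -/

section Acyclic

variable {V : Type*}

/-- The edge set `F` carries no nonzero circulation. This linear form of being a forest is easier to
transport along changes of the graph than the absence of cycles, and is equivalent to it (see
`acyclic_of_noCycles` and `noCycles_of_acyclic`). -/
def Acyclic (F : Finset (V × V)) : Prop :=
  ∀ d : V × V →₀ ℝ, d.support ⊆ F → div d = 0 → d = 0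

lemma Acyclic.mono {F F' : Finset (V × V)} (h : Acyclic F) (hF : F' ⊆ F) : Acyclic F' :=
  fun d hd => h d (hd.trans hF)

/-- A walk in the underlying undirected graph, read as a chain with signs. -/
lemma exists_chain_of_reachable {F : Finset (V × V)} {H : SimpleGraph V}
    (hH : ∀ u v, H.Adj u v → (u, v) ∈ F ∨ (v, u) ∈ F) {a b : V} (h : H.Reachable a b) :
    ∃ d : V × V →₀ ℝ, (∀ e ∈ d.support, e ∈ F ∧ H.Adj e.1 e.2) ∧
      div d = Finsupp.single a 1 - Finsupp.single b 1 := by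
  classical
  obtain ⟨p⟩ := h
  induction p with
  | nil => exact ⟨0, by simp, by simp⟩
  | @cons u v w hadj _ ih =>
    obtain ⟨d, hd, hdiv⟩ := ih
    rcases hH _ _ hadj with huv | huv
    · refine ⟨Finsupp.single (u, v) 1 + d, fun e he => ?_, by rw [map_add, hdiv]; simp⟩
      rcases Finset.mem_union.1 (Finsupp.support_add he) with h | h
      · obtain rfl := Finset.mem_singleton.1 (Finsupp.support_single_subset h)
        exact ⟨huv, hadj⟩
      · exact hd e h
    · refine ⟨Finsupp.single (v, u) (-1) + d, fun e he => ?_, ?_⟩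
      · rcases Finset.mem_union.1 (Finsupp.support_add he) with h | h
        · obtain rfl := Finset.mem_singleton.1 (Finsupp.support_single_subset h)
          exact ⟨huv, hadj.symm⟩
        · exact hd e h
      · rw [map_add, hdiv]; simp

lemma acyclic_of_noCycles {G : WeightedGraph V} (h : G.NoCycles) : Acyclic G.edges := by
  classical
  intro d hd hdiv
  by_contra hne
  obtain ⟨⟨u, v⟩, he⟩ := Finsupp.support_nonempty_iff.2 hne
  have hE := hd he
  have huv : u ≠ v := by rintro rfl; exact h.1 _ _ hE hE
  set H := SimpleGraph.fromRel fun u v => (u, v) ∈ G.edges with hHdef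
  have hb := SimpleGraph.isAcyclic_iff_forall_adj_isBridge.1 h.2
    ((SimpleGraph.fromRel_adj _ u v).2 ⟨huv, Or.inl hE⟩)
  rw [SimpleGraph.isBridge_iff] at hb
  -- Test the divergence against the indicator of one of the two sides of the bridge.
  let A : V → ℝ := fun z => if (H.deleteEdges {s(u, v)}).Reachable u z then 1 else 0
  have key := linearCombination_div A d
  rw [hdiv, map_zero, Finsupp.sum, Finset.sum_eq_single (u, v)] at key
  · have hu : A u = 1 := if_pos (SimpleGraph.Reachable.refl u)
    have hv : A v = 0 := if_neg hb
    rw [hu, hv] at key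
    simp at key
    exact Finsupp.mem_support_iff.1 he key.symm
  · rintro ⟨a, b⟩ hab hne'
    have habE := hd hab
    have hab' : a ≠ b := by rintro rfl; exact h.1 _ _ habE habE
    have hadj : (H.deleteEdges {s(u, v)}).Adj a b := by
      rw [SimpleGraph.deleteEdges_adj]
      refine ⟨(SimpleGraph.fromRel_adj _ a b).2 ⟨hab', Or.inl habE⟩, ?_⟩
      rw [Set.mem_singleton_iff, Sym2.eq_iff]
      rintro (⟨rfl, rfl⟩ | ⟨rfl, rfl⟩)
      · exact hne' rfl
      · exact h.1 _ _ hE habE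
    have : A a = A b := by
      simp only [A]
      congr 1
      exact propext ⟨fun h => h.trans hadj.reachable, fun h => h.trans hadj.symm.reachable⟩
    simp [this]
  · intro h'; exact absurd he h'

lemma noCycles_of_acyclic {G : WeightedGraph V} (h : Acyclic G.edges) : G.NoCycles := by
  classical
  have hanti : ∀ u v, (u, v) ∈ G.edges → (v, u) ∉ G.edges := by
    intro u v huv hvu
    have := h (Finsupp.single (u, v) 1 + Finsupp.single (v, u) 1) (fun e he => ?_) (by simp)
    · have h2 := DFunLike.congr_fun this (u, v)
      simp only [Finsupp.add_apply, Finsupp.single_apply, Finsupp.zero_apply] at h2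
      split_ifs at h2 <;> norm_num at h2
    · rcases Finset.mem_union.1 (Finsupp.support_add he) with h | h <;>
        obtain rfl := Finset.mem_singleton.1 (Finsupp.support_single_subset h) <;> assumption
  refine ⟨hanti, SimpleGraph.isAcyclic_iff_forall_adj_isBridge.2 ?_⟩
  set H := SimpleGraph.fromRel fun u v => (u, v) ∈ G.edges with hHdef
  have hedge : ∀ u v, (u, v) ∈ G.edges → ¬ (H.deleteEdges {s(u, v)}).Reachable u v := by
    intro u v huv hr
    obtain ⟨d, hd, hdiv⟩ := exists_chain_of_reachable (F := G.edges)
      (H := H.deleteEdges {s(u, v)}) (fun a b hab =>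
        ((SimpleGraph.fromRel_adj _ a b).1 (SimpleGraph.deleteEdges_adj.1 hab).1).2) hr
    have := h (Finsupp.single (u, v) 1 - d) (fun e he => ?_) (by rw [map_sub, hdiv]; simp)
    · have hduv : d (u, v) = 0 := by
        by_contra hne
        have := (hd (u, v) (Finsupp.mem_support_iff.2 hne)).2
        simp [SimpleGraph.deleteEdges_adj] at this
      have h2 := DFunLike.congr_fun this (u, v)
      simp [hduv] at h2
    · rcases Finset.mem_union.1 (Finsupp.support_sub he) with h | h
      · obtain rfl := Finset.mem_singleton.1 (Finsupp.support_single_subset h); exact huv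
      · exact (hd e h).1
  intro u v huv
  rw [SimpleGraph.isBridge_iff]
  rcases ((SimpleGraph.fromRel_adj _ u v).1 huv).2 with h' | h'
  · exact hedge u v h'
  · intro hr
    rw [Sym2.eq_swap] at hr
    exact hedge v u h' hr.symm

end Acyclic

/-! ### Real weights and the chains of curves -/

section Curves

variable {V A : Type*}

/-- A nonnegative weight as a real-valued one. -/
noncomputable def toReal (w : A →₀ ℝ≥0) : A →₀ ℝ :=
  w.mapRange (fun r : ℝ≥0 => (r : ℝ)) NNReal.coe_zero

@[simp] lemma toReal_apply (w : A →₀ ℝ≥0) (a : A) : toReal w a = w a := rfl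

lemma toReal_nonneg (w : A →₀ ℝ≥0) : 0 ≤ toReal w := fun a => (w a).2

lemma toReal_injective : Function.Injective (toReal : (A →₀ ℝ≥0) → A →₀ ℝ) := fun w w' h => by
  ext a; exact DFunLike.congr_fun h a

@[simp] lemma support_toReal (w : A →₀ ℝ≥0) : (toReal w).support = w.support := by
  ext a; simp

@[simp] lemma toReal_zero : toReal (0 : A →₀ ℝ≥0) = 0 := by ext; simp

lemma toReal_add (w w' : A →₀ ℝ≥0) : toReal (w + w') = toReal w + toReal w' := by ext; simp

lemma toReal_smul (c : ℝ≥0) (w : A →₀ ℝ≥0) : toReal (c • w) = (c : ℝ) • toReal w := by ext; simp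

lemma toReal_sum {ι : Type*} (s : Finset ι) (w : ι → A →₀ ℝ≥0) :
    toReal (∑ i ∈ s, w i) = ∑ i ∈ s, toReal (w i) := by
  ext a; simp [Finsupp.finsetSum_apply]

lemma toReal_single (a : A) (c : ℝ≥0) : toReal (Finsupp.single a c) = Finsupp.single a (c : ℝ) := by
  classical
  ext b; simp only [toReal_apply, Finsupp.single_apply]; split_ifs <;> simp

lemma curveChain_apply [DecidableEq V] (p : List V) (e : V × V) :
    curveChain p e = if e ∈ p.zip p.tail then 1 else 0 := by
  classical
  simp [curveChain, Finsupp.finsetSum_apply, Finsupp.single_apply]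

lemma mem_zip_tail_of_isChain {r : V → V → Prop} {p : List V} (h : p.IsChain r) :
    ∀ e ∈ p.zip p.tail, r e.1 e.2 := by
  induction p with
  | nil => simp
  | cons a t ih =>
    cases t with
    | nil => simp
    | cons c t =>
      rw [List.isChain_cons_cons] at h
      intro e he
      rw [List.tail_cons, List.zip_cons_cons, List.mem_cons] at he
      rcases he with rfl | he
      · exact h.1
      · exact ih h.2 e he

lemma rel_of_curveChain_ne_zero {r : V → V → Prop} {p : List V} (h : p.IsChain r) {e : V × V}
    (he : curveChain p e ≠ 0) : r e.1 e.2 := by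
  classical
  rw [curveChain_apply] at he
  exact mem_zip_tail_of_isChain h e (by by_contra hne; simp [hne] at he)

lemma curveChain_cons_cons {a c : V} {t : List V} (h : (a :: c :: t).Nodup) :
    curveChain (a :: c :: t) = Finsupp.single (a, c) 1 + curveChain (c :: t) := by
  classical
  have : (a, c) ∉ ((c :: t).zip t).toFinset := fun hm =>
    (List.nodup_cons.1 h).1 (List.of_mem_zip (List.mem_toFinset.1 hm)).1
  unfold curveChain
  rw [List.tail_cons, List.zip_cons_cons, List.toFinset_cons, List.tail_cons]
  convert Finset.sum_insert this using 2

lemma div_curveChain {p : List V} {a b : V} (ha : p.head? = some a) (hb : p.getLast? = some b)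
    (hp : p.Nodup) : div (toReal (curveChain p)) = Finsupp.single a 1 - Finsupp.single b 1 := by
  induction p generalizing a with
  | nil => simp at ha
  | cons c t ih =>
    obtain rfl : c = a := by simpa using ha
    cases t with
    | nil =>
      obtain rfl : c = b := by simpa using hb
      simp [curveChain]
    | cons d t =>
      rw [curveChain_cons_cons hp, toReal_add, map_add, toReal_single, div_single,
        ih rfl (by simpa using hb) (List.nodup_cons.1 hp).2]
      simp

lemma exists_nodup_chain_of_reflTransGen {r : V → V → Prop} {a b : V}
    (h : Relation.ReflTransGen r a b) :
    ∃ p : List V, p.head? = some a ∧ p.getLast? = some b ∧ p.Nodup ∧ p.IsChain r := by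
  induction h using Relation.ReflTransGen.head_induction_on with
  | refl => exact ⟨[b], by simp⟩
  | @head a c hac _ ih =>
    obtain ⟨p, hp, hb, hnd, hch⟩ := ih
    by_cases ha : a ∈ p
    · obtain ⟨s, t, rfl⟩ := List.append_of_mem ha
      refine ⟨a :: t, rfl, ?_, hnd.of_append_right, hch.right_of_append⟩
      rwa [List.getLast?_append_of_ne_nil _ (by simp)] at hb
    · cases p with
      | nil => simp at hp
      | cons d t =>
        obtain rfl : d = c := by simpa using hp
        exact ⟨a :: d :: t, rfl, by simpa using hb, List.nodup_cons.2 ⟨ha, hnd⟩,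
          List.isChain_cons_cons.2 ⟨hac, hch⟩⟩

end Curves

/-! ### Flows -/

section Flow

variable {V ι : Type*}

/-- A flow in `X` which meets the demand `b` from sources among the points `x i`. The production at
a vertex is the excess `div W + b`; it is free at the sources, apart from its sign, and vanishes
elsewhere. Loops are excluded because they have length zero and cost nothing. -/
structure IsFlow (X : Set V) (x : ι → V) (b : V →₀ ℝ) (W : V × V →₀ ℝ) : Prop where
  nonneg : 0 ≤ W
  loopless : ∀ v, W (v, v) = 0
  mem : ∀ e, W e ≠ 0 → e.1 ∈ X ∧ e.2 ∈ X
  excess_nonneg : ∀ v, 0 ≤ div W v + b v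
  excess_eq_zero : ∀ v, v ∉ Set.range x → div W v + b v = 0

/-- The only chain on `F` with divergence supported at the points `x i` is zero. This says at once
that `F` is a forest and that no component of it contains two of the points `x i`. -/
def Rigid (x : ι → V) (F : Finset (V × V)) : Prop :=
  ∀ d : V × V →₀ ℝ, d.support ⊆ F → (∀ v, v ∉ Set.range x → div d v = 0) → d = 0

lemma Rigid.acyclic {x : ι → V} {F : Finset (V × V)} (h : Rigid x F) : Acyclic F :=
  fun d hd h0 => h d hd fun v _ => by rw [h0]; rfl

/-- The shape of the cost-minimal flows: nothing flows into a source, and the support is rigid. -/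
structure IsReduced (x : ι → V) (W : V × V →₀ ℝ) : Prop where
  noInflow : ∀ u i, W (u, x i) = 0
  rigid : Rigid x W.support

/-- `(u, v)` is an edge of the support of `W`. -/
def Arc (W : V × V →₀ ℝ) (u v : V) : Prop := W (u, v) ≠ 0

lemma exists_chain_of_transGen {W : V × V →₀ ℝ} {a b : V} (h : Relation.TransGen (Arc W) a b) :
    ∃ τ : V × V →₀ ℝ, 0 ≤ τ ∧ (∃ e, 0 < τ e) ∧ τ.support ⊆ W.support ∧
      div τ = Finsupp.single a 1 - Finsupp.single b 1 := by
  classical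
  induction h with
  | @single c h =>
    refine ⟨Finsupp.single (a, c) 1, Finsupp.single_nonneg.2 zero_le_one, ⟨(a, c), by simp⟩, ?_,
      by simp⟩
    exact Finsupp.support_single_subset.trans
      (Finset.singleton_subset_iff.2 (Finsupp.mem_support_iff.2 h))
  | @tail c d _ h ih =>
    obtain ⟨τ, h0, ⟨e, he⟩, hs, hdiv⟩ := ih
    have h1 : (0 : V × V →₀ ℝ) ≤ Finsupp.single (c, d) 1 := Finsupp.single_nonneg.2 zero_le_one
    refine ⟨τ + Finsupp.single (c, d) 1, add_nonneg h0 h1, ⟨e, add_pos_of_pos_of_nonneg he (h1 e)⟩,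
      Finsupp.support_add.trans (Finset.union_subset hs (Finsupp.support_single_subset.trans
        (Finset.singleton_subset_iff.2 (Finsupp.mem_support_iff.2 h)))), ?_⟩
    rw [map_add, hdiv, div_single]; simp

lemma Acyclic.not_transGen {W : V × V →₀ ℝ} (h : Acyclic W.support) (a : V) :
    ¬ Relation.TransGen (Arc W) a a := fun ha => by
  obtain ⟨τ, -, ⟨e, he⟩, hs, hdiv⟩ := exists_chain_of_transGen ha
  rw [h τ hs (by simpa using hdiv)] at he
  exact lt_irrefl _ he

lemma div_nonneg_of_noInflow {W : V × V →₀ ℝ} (hW : 0 ≤ W) {v : V} (hv : ∀ u, W (u, v) = 0) :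
    0 ≤ div W v := by
  classical
  rw [div_apply, sub_nonneg]
  rw [Finset.sum_eq_zero (s := W.support.filter fun e => e.2 = v)]
  · exact Finset.sum_nonneg fun e _ => hW e
  · rintro ⟨a, c⟩ he
    obtain rfl : c = v := (Finset.mem_filter.1 he).2
    exact hv a

lemma div_pos_of_noInflow {W : V × V →₀ ℝ} (hW : 0 ≤ W) {v w : V} (hv : ∀ u, W (u, v) = 0)
    (hw : Arc W v w) : 0 < div W v := by
  classical
  rw [div_apply, sub_pos]
  rw [Finset.sum_eq_zero (s := W.support.filter fun e => e.2 = v)]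
  · refine Finset.sum_pos (fun e he => ?_) ⟨(v, w), by simpa [Arc] using hw⟩
    exact lt_of_le_of_ne (hW e) (Finsupp.mem_support_iff.1 (Finset.mem_filter.1 he).1).symm
  · rintro ⟨a, c⟩ he
    obtain rfl : c = v := (Finset.mem_filter.1 he).2
    exact hv a

/-- Following the arcs backwards from a vertex, one ends at a vertex without inflow. -/
lemma exists_root {W : V × V →₀ ℝ} (hirr : ∀ a, ¬ Relation.TransGen (Arc W) a a) {u v : V}
    (huv : Arc W u v) : ∃ z, Relation.TransGen (Arc W) z v ∧ ∀ u, W (u, z) = 0 := by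
  classical
  have : IsStrictOrder V (Relation.TransGen (Arc W)) :=
    { irrefl := hirr, trans := fun _ _ _ => Relation.TransGen.trans }
  let s : Set V := {z | Relation.TransGen (Arc W) z v}
  have hs : s.Finite := by
    refine (W.support.image Prod.fst).finite_toSet.subset fun z hz => ?_
    obtain ⟨w, hw, -⟩ := Relation.TransGen.head'_iff.1 hz
    exact Finset.mem_coe.2 (Finset.mem_image.2 ⟨(z, w), Finsupp.mem_support_iff.2 hw, rfl⟩)
  have hwf : WellFounded fun a b : s => Relation.TransGen (Arc W) a b := hs.wellFoundedOn
  obtain ⟨z, -, hz⟩ := hwf.has_min Set.univ ⟨⟨u, .single huv⟩, trivial⟩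
  refine ⟨z, z.2, fun w => ?_⟩
  by_contra hw
  exact hz ⟨w, Relation.TransGen.head hw z.2⟩ trivial (.single hw)

/-- Moving from `W` in the direction `σ` until the first edge vanishes. -/
lemma exists_step {W σ : V × V →₀ ℝ} (hW : 0 ≤ W) (hσ : σ.support ⊆ W.support)
    (hneg : ∃ e, σ e < 0) :
    ∃ t : ℝ, 0 < t ∧ 0 ≤ W + t • σ ∧ ∃ e, 0 < W e ∧ (W + t • σ) e = 0 := by
  classical
  obtain ⟨e₁, he₁⟩ := hneg
  obtain ⟨e₀, he₀, hmin⟩ := Finset.exists_min_image (σ.support.filter fun e => σ e < 0)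
    (fun e => W e / (-σ e)) ⟨e₁, by simp [he₁, he₁.ne]⟩
  have hn : σ e₀ < 0 := (Finset.mem_filter.1 he₀).2
  have hpos : ∀ e, σ e < 0 → 0 < W e := fun e he =>
    lt_of_le_of_ne (hW e) (Finsupp.mem_support_iff.1 (hσ (Finsupp.mem_support_iff.2 he.ne))).symm
  have ht : 0 < W e₀ / (-σ e₀) := div_pos (hpos _ hn) (neg_pos.2 hn)
  refine ⟨_, ht, fun e => ?_, e₀, hpos _ hn, ?_⟩
  · simp only [Finsupp.coe_zero, Pi.zero_apply, Finsupp.add_apply, Finsupp.smul_apply, smul_eq_mul]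
    rcases lt_or_ge (σ e) 0 with h | h
    · have := hmin e (Finset.mem_filter.2 ⟨Finsupp.mem_support_iff.2 h.ne, h⟩)
      rw [le_div_iff₀ (neg_pos.2 h)] at this
      linarith
    · exact add_nonneg (hW e) (mul_nonneg ht.le h)
  · simp only [Finsupp.add_apply, Finsupp.smul_apply, smul_eq_mul]
    field_simp [hn.ne]
    ring

lemma support_add_smul_subset {W σ : V × V →₀ ℝ} (hσ : σ.support ⊆ W.support) (t : ℝ) :
    (W + t • σ).support ⊆ W.support := by
  classical
  exact Finsupp.support_add.trans
    (Finset.union_subset subset_rfl (Finsupp.support_smul.trans hσ))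

lemma ssubset_support {W W' : V × V →₀ ℝ} (h : W'.support ⊆ W.support) {e : V × V}
    (he : 0 < W e) (he' : W' e = 0) : W'.support ⊂ W.support :=
  Finset.ssubset_iff_subset_ne.2 ⟨h, fun heq => by
    have : e ∈ W'.support := by rw [heq]; exact Finsupp.mem_support_iff.2 he.ne'
    exact Finsupp.mem_support_iff.1 this he'⟩

lemma IsFlow.of_support_subset {X : Set V} {x : ι → V} {b : V →₀ ℝ} {W W' : V × V →₀ ℝ}
    (h : IsFlow X x b W) (hs : W'.support ⊆ W.support) (h0 : 0 ≤ W')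
    (hex : ∀ v, 0 ≤ div W' v + b v) (hex0 : ∀ v, v ∉ Set.range x → div W' v + b v = 0) :
    IsFlow X x b W' := by
  have hz : ∀ e, W e = 0 → W' e = 0 := fun e he => by
    by_contra hne
    exact Finsupp.mem_support_iff.1 (hs (Finsupp.mem_support_iff.2 hne)) he
  exact ⟨h0, fun v => hz _ (h.loopless v), fun e he => h.mem e (mt (hz e) he), hex, hex0⟩

end Flow

/-! ### Improving flows that are not reduced -/

section Improvement

variable {V ι : Type*} [MetricSpace V]

/-- The length of the segment from `e.1` to `e.2`. -/
def edgeLength (e : V × V) : ℝ := dist e.1 e.2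

lemma edgeLength_nonneg (e : V × V) : 0 ≤ edgeLength e := dist_nonneg

lemma IsFlow.edgeLength_pos {X : Set V} {x : ι → V} {b : V →₀ ℝ} {W : V × V →₀ ℝ}
    (h : IsFlow X x b W) {e : V × V} (he : 0 < W e) : 0 < edgeLength e := by
  obtain ⟨u, v⟩ := e
  refine dist_pos.2 fun huv => ?_
  obtain rfl : u = v := huv
  exact he.ne' (h.loopless u)

/-- Decreasing a flow along a nonnegative chain until an edge vanishes makes it strictly cheaper. -/
lemma IsFlow.exists_lt_of_chain {X : Set V} {x : ι → V} {b : V →₀ ℝ} {W τ : V × V →₀ ℝ} {α : ℝ}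
    (hα : 0 ≤ α) (h : IsFlow X x b W) (hτ : 0 ≤ τ) (hpos : ∃ e, 0 < τ e)
    (hs : τ.support ⊆ W.support) (hdiv : ∀ v, v ∉ Set.range x → div τ v = 0)
    (hex : ∀ t : ℝ, 0 < t → 0 ≤ W + t • -τ → ∀ v, 0 ≤ div (W + t • -τ) v + b v) :
    ∃ W', IsFlow X x b W' ∧ W'.support ⊂ W.support ∧
      chainCost α edgeLength W' < chainCost α edgeLength W := by
  have hs' : (-τ).support ⊆ W.support := by rwa [Finsupp.support_neg]
  obtain ⟨t, ht, h0, e, he, he0⟩ := exists_step h.nonneg hs'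
    (by obtain ⟨e, he⟩ := hpos; exact ⟨e, by simpa using he⟩)
  have hsub := support_add_smul_subset hs' t
  refine ⟨W + t • -τ, h.of_support_subset hsub h0 (hex t ht h0) fun v hv => ?_,
    ssubset_support hsub he he0, chainCost_lt hα edgeLength_nonneg h0 ?_ he0 he
      (h.edgeLength_pos he)⟩
  · have := h.excess_eq_zero v hv
    simpa [hdiv v hv] using this
  · intro e
    have := mul_nonneg ht.le (hτ e)
    simpa using this

/-- A flow that is not reduced can be made strictly cheaper on a smaller support. Directed cycles
and inflow at sources are cancelled. Otherwise the support carries a nonzero chain `σ` which leaves the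
balance off the sources unchanged, and, by concavity, one of the two directions `±σ` pays off. -/
theorem IsFlow.exists_lt_of_not_isReduced {X : Set V} {x : ι → V} {b : V →₀ ℝ} (hb : 0 ≤ b)
    {W : V × V →₀ ℝ} {α : ℝ} (hα : 0 ≤ α) (hα1 : α < 1) (h : IsFlow X x b W)
    (hred : ¬ IsReduced x W) :
    ∃ W', IsFlow X x b W' ∧ W'.support ⊂ W.support ∧
      chainCost α edgeLength W' < chainCost α edgeLength W := by
  classical
  by_cases hcyc : ∃ a, Relation.TransGen (Arc W) a a
  · obtain ⟨a, ha⟩ := hcyc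
    obtain ⟨τ, h0, hpos, hs, hdiv⟩ := exists_chain_of_transGen ha
    rw [sub_self] at hdiv
    refine h.exists_lt_of_chain hα h0 hpos hs (fun v _ => by rw [hdiv]; rfl) fun t _ _ v => ?_
    simpa [hdiv] using h.excess_nonneg v
  push Not at hcyc
  by_cases hin : ∃ u i, Arc W u (x i)
  · obtain ⟨u, i, hui⟩ := hin
    obtain ⟨z, hz, hz0⟩ := exists_root hcyc hui
    obtain ⟨w, hzw, -⟩ := Relation.TransGen.head'_iff.1 hz
    have hzx : z ∈ Set.range x := by
      by_contra hne
      have h1 := h.excess_eq_zero z hne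
      have h2 := div_pos_of_noInflow h.nonneg hz0 hzw
      have h3 : 0 ≤ b z := hb z
      linarith
    have hzi : z ≠ x i := by rintro rfl; exact hcyc _ hz
    obtain ⟨τ, h0, hpos, hs, hdiv⟩ := exists_chain_of_transGen hz
    refine h.exists_lt_of_chain hα h0 hpos hs (fun v hv => ?_) fun t ht hn v => ?_
    · have h1 : z ≠ v := by rintro rfl; exact hv hzx
      have h2 : x i ≠ v := by rintro rfl; exact hv ⟨i, rfl⟩
      simp [hdiv, h1, h2]
    · by_cases hvz : v = z
      · subst hvz
        refine add_nonneg (div_nonneg_of_noInflow hn fun u => ?_) (hb v)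
        by_contra hne
        exact Finsupp.mem_support_iff.1 (support_add_smul_subset
          (by rwa [Finsupp.support_neg]) t (Finsupp.mem_support_iff.2 hne)) (hz0 u)
      · have h1 := h.excess_nonneg v
        have h2 : 0 ≤ t * (Finsupp.single (x i) (1 : ℝ) v) :=
          mul_nonneg ht.le (Finsupp.single_nonneg.2 zero_le_one v)
        simp only [map_add, map_smul, map_neg, hdiv, Finsupp.add_apply, Finsupp.smul_apply,
          Finsupp.neg_apply, Finsupp.sub_apply, smul_eq_mul,
          Finsupp.single_eq_of_ne hvz]
        linarith
  push Not at hin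
  have hin0 : ∀ u i, W (u, x i) = 0 := fun u i => not_not.1 (hin u i)
  have hrig : ¬ Rigid x W.support := fun hr => hred ⟨hin0, hr⟩
  unfold Rigid at hrig
  push Not at hrig
  obtain ⟨σ, hs, hdiv, hne⟩ := hrig
  -- Without inflow at the sources, every nonnegative perturbation along `σ` is again a flow.
  have hflow : ∀ t : ℝ, 0 ≤ W + t • σ → IsFlow X x b (W + t • σ) := by
    intro t h0
    have hsub := support_add_smul_subset hs t
    have h1 : ∀ v, v ∉ Set.range x → div (W + t • σ) v + b v = 0 := fun v hv => by
      have := h.excess_eq_zero v hv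
      simpa [hdiv v hv] using this
    refine h.of_support_subset hsub h0 (fun v => ?_) h1
    by_cases hv : v ∈ Set.range x
    · obtain ⟨i, rfl⟩ := hv
      refine add_nonneg (div_nonneg_of_noInflow h0 fun u => ?_) (hb _)
      by_contra hne
      exact Finsupp.mem_support_iff.1 (hsub (Finsupp.mem_support_iff.2 hne)) (hin0 u i)
    · exact (h1 v hv).ge
  have hsn : (-σ).support ⊆ W.support := by rwa [Finsupp.support_neg]
  by_cases hn : ∃ e, σ e < 0
  · obtain ⟨t, ht, ht0, e, he, he0⟩ := exists_step h.nonneg hs hn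
    have hsub := support_add_smul_subset hs t
    by_cases hp : ∃ e, 0 < σ e
    · obtain ⟨s, hs', hs0, e', he', he0'⟩ := exists_step h.nonneg hsn
        (by obtain ⟨e, he⟩ := hp; exact ⟨e, by simpa using he⟩)
      have hsub' := support_add_smul_subset hsn s
      have hsum : 0 < s + t := by positivity
      have hcomb : (s / (s + t)) • (W + t • σ) + (t / (s + t)) • (W + s • -σ) = W := by
        ext e
        simp only [Finsupp.add_apply, Finsupp.smul_apply, Finsupp.neg_apply, smul_eq_mul]
        field_simp
        ring
      have hBe : 0 < (W + s • -σ) e := by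
        refine lt_of_le_of_ne (hs0 e) fun hz => he.ne' ?_
        rw [← hcomb]
        simp only [Finsupp.add_apply, Finsupp.smul_apply] at he0 hz ⊢
        rw [he0, ← hz]; simp
      have key := chainCost_concave_lt hα hα1 edgeLength_nonneg ht0 hs0
        (div_pos hs' hsum) (div_pos ht hsum) (by field_simp) he0 hBe (h.edgeLength_pos he)
      rw [hcomb] at key
      by_contra! hcon
      have c1 := hcon _ (hflow t ht0) (ssubset_support hsub he he0)
      have c2 := hcon _ (by simpa using hflow (-s) (by simpa using hs0))
        (ssubset_support hsub' he' he0')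
      have m1 := mul_le_mul_of_nonneg_left c1 (div_pos hs' hsum).le
      have m2 := mul_le_mul_of_nonneg_left c2 (div_pos ht hsum).le
      have : s / (s + t) * chainCost α edgeLength W + t / (s + t) * chainCost α edgeLength W
          = chainCost α edgeLength W := by field_simp
      linarith
    · push Not at hp
      refine ⟨_, hflow t ht0, ssubset_support hsub he he0,
        chainCost_lt hα edgeLength_nonneg ht0 (fun e => ?_) he0 he (h.edgeLength_pos he)⟩
      have := mul_nonpos_of_nonneg_of_nonpos ht.le (hp e)
      simpa using this
  · push Not at hn
    obtain ⟨e, he⟩ := Finsupp.ne_iff.1 hne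
    refine h.exists_lt_of_chain hα (fun e => hn e) ⟨e, lt_of_le_of_ne (hn e) (Ne.symm he)⟩ hs hdiv
      fun t _ h0 v => ?_
    have := (hflow (-t) (by simpa using h0)).excess_nonneg v
    simpa using this

/-- Every flow costs at least as much as some reduced flow, by induction on the size of the
support. -/
theorem IsFlow.exists_isReduced {X : Set V} {x : ι → V} {b : V →₀ ℝ} (hb : 0 ≤ b)
    {W : V × V →₀ ℝ} {α : ℝ} (hα : 0 ≤ α) (hα1 : α < 1) (h : IsFlow X x b W) :
    ∃ W', IsFlow X x b W' ∧ IsReduced x W' ∧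
      chainCost α edgeLength W' ≤ chainCost α edgeLength W := by
  induction hn : W.support.card using Nat.strong_induction_on generalizing W with
  | _ n ih =>
    by_cases hred : IsReduced x W
    · exact ⟨W, h, hred, le_rfl⟩
    · obtain ⟨W₁, h₁, hs, hlt⟩ := h.exists_lt_of_not_isReduced hb hα hα1 hred
      obtain ⟨W', h', hr, hle⟩ := ih _ (hn ▸ Finset.card_lt_card hs) h₁ rfl
      exact ⟨W', h', hr, hle.trans hlt.le⟩

end Improvement

/-! ### Curve representation of rigid flows -/

section Representation

variable {V ι κ : Type*} [Fintype κ]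

/-- The measure `∑ n_j δ_{y_j}` with real coefficients. -/
noncomputable def demand (y : κ → V) (n : κ → ℝ≥0) : V →₀ ℝ := toReal (atomic y n)

lemma demand_eq_sum (y : κ → V) (n : κ → ℝ≥0) :
    demand y n = ∑ j, Finsupp.single (y j) (n j : ℝ) := by
  simp [demand, atomic, toReal_sum, toReal_single]

lemma demand_nonneg (y : κ → V) (n : κ → ℝ≥0) : 0 ≤ demand y n := toReal_nonneg _

lemma demand_pos (y : κ → V) {n : κ → ℝ≥0} {j : κ} (hj : n j ≠ 0) : 0 < demand y n (y j) := by
  rw [demand_eq_sum, Finsupp.finsetSum_apply]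
  refine Finset.sum_pos' (fun i _ => Finsupp.single_nonneg.2 (n i).2 _) ⟨j, Finset.mem_univ _, ?_⟩
  simpa using pos_iff_ne_zero.2 hj

/-- A flow with rigid support is the superposition of one curve for each household, of weight the
demand of the household: both have the same divergence off the sources, so rigidity identifies them.
In particular such a flow splits no household between two factories. -/
theorem IsFlow.exists_curves [Nonempty ι] {X : Set V} {x : ι → V} {y : κ → V} {n : κ → ℝ≥0}
    {W : V × V →₀ ℝ} (h : IsFlow X x (demand y n) W) (hrig : Rigid x W.support) :
    ∃ (S : κ → ι) (g : κ → List V), (∀ j, n j ≠ 0 → (g j).head? = some (x (S j)) ∧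
      (g j).getLast? = some (y j) ∧ (g j).Nodup ∧ (g j).IsChain (Arc W)) ∧
      W = ∑ j, (n j : ℝ) • toReal (curveChain (g j)) := by
  have hirr := hrig.acyclic.not_transGen
  have hroot : ∀ j, ∃ i, n j ≠ 0 → Relation.ReflTransGen (Arc W) (x i) (y j) := by
    intro j
    by_cases hj : n j = 0
    · exact ⟨Classical.arbitrary ι, fun h => absurd hj h⟩
    by_cases hin : ∃ u, Arc W u (y j)
    · obtain ⟨u, hu⟩ := hin
      obtain ⟨z, hz, hz0⟩ := exists_root hirr hu
      obtain ⟨w, hzw, -⟩ := Relation.TransGen.head'_iff.1 hz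
      have hzx : z ∈ Set.range x := by
        by_contra hne
        have h1 := h.excess_eq_zero z hne
        have h2 := div_pos_of_noInflow h.nonneg hz0 hzw
        have h3 : 0 ≤ demand y n z := demand_nonneg y n z
        linarith
      obtain ⟨i, rfl⟩ := hzx
      exact ⟨i, fun _ => hz.to_reflTransGen⟩
    · push Not at hin
      have hyx : y j ∈ Set.range x := by
        by_contra hne
        have h1 := h.excess_eq_zero _ hne
        have h2 := div_nonneg_of_noInflow h.nonneg fun u => not_not.1 (hin u)
        have h3 := demand_pos y hj
        linarith
      obtain ⟨i, hi⟩ := hyx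
      exact ⟨i, fun _ => hi ▸ Relation.ReflTransGen.refl⟩
  choose S hS using hroot
  have hcurve : ∀ j, ∃ p : List V, n j ≠ 0 → p.head? = some (x (S j)) ∧
      p.getLast? = some (y j) ∧ p.Nodup ∧ p.IsChain (Arc W) := fun j => by
    by_cases hj : n j = 0
    · exact ⟨[], fun h => absurd hj h⟩
    · obtain ⟨p, hp⟩ := exists_nodup_chain_of_reflTransGen (hS j hj)
      exact ⟨p, fun _ => hp⟩
  choose g hg using hcurve
  refine ⟨S, g, hg, sub_eq_zero.1 (hrig _ ?_ fun v hv => ?_)⟩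
  · classical
    intro e he
    rw [Finsupp.mem_support_iff] at he ⊢
    intro h0
    refine he ?_
    rw [Finsupp.sub_apply, h0, Finsupp.finsetSum_apply, Finset.sum_eq_zero, sub_zero]
    intro j _
    by_cases hj : n j = 0
    · simp [hj]
    have : curveChain (g j) e = 0 := by
      by_contra hne
      exact rel_of_curveChain_ne_zero (hg j hj).2.2.2 hne h0
    simp [this]
  · have h1 := h.excess_eq_zero v hv
    have hx : ∀ i, Finsupp.single (x i) (1 : ℝ) v = 0 := fun i =>
      Finsupp.single_eq_of_ne (by rintro rfl; exact hv ⟨i, rfl⟩)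
    rw [demand_eq_sum, Finsupp.finsetSum_apply] at h1
    rw [map_sub, map_sum, Finsupp.sub_apply, Finsupp.finsetSum_apply, sub_eq_zero,
      eq_neg_of_add_eq_zero_left h1, ← Finset.sum_neg_distrib]
    refine Finset.sum_congr rfl fun j _ => ?_
    by_cases hj : n j = 0
    · simp [hj]
    rw [map_smul, div_curveChain (hg j hj).1 (hg j hj).2.1 (hg j hj).2.2.1]
    classical
    simp [hx, Finsupp.single_apply]

end Representation

/-! ### Vertex count of a forest -/

section Counting

variable {V : Type*}

open Classical in
/-- The endpoints of the edges in `F`. -/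
noncomputable def endpoints (F : Finset (V × V)) : Finset V := F.image Prod.fst ∪ F.image Prod.snd

open Classical in
/-- The number of edges of `F` that start or end at `v`. -/
noncomputable def degree (F : Finset (V × V)) (v : V) : ℕ :=
  (F.filter fun e => e.1 = v).card + (F.filter fun e => e.2 = v).card

lemma fst_mem_endpoints {F : Finset (V × V)} {e : V × V} (he : e ∈ F) : e.1 ∈ endpoints F := by
  classical
  exact Finset.mem_union_left _ (Finset.mem_image_of_mem _ he)

lemma snd_mem_endpoints {F : Finset (V × V)} {e : V × V} (he : e ∈ F) : e.2 ∈ endpoints F := by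
  classical
  exact Finset.mem_union_right _ (Finset.mem_image_of_mem _ he)

lemma sum_degree (F : Finset (V × V)) : ∑ v ∈ endpoints F, degree F v = 2 * F.card := by
  classical
  unfold degree
  rw [Finset.sum_add_distrib,
    ← Finset.card_eq_sum_card_fiberwise (s := F) (t := endpoints F) (f := Prod.fst)
      fun e he => fst_mem_endpoints he,
    ← Finset.card_eq_sum_card_fiberwise (s := F) (t := endpoints F) (f := Prod.snd)
      fun e he => snd_mem_endpoints he]
  ring

open Classical in
lemma div_apply_of_subset {d : V × V →₀ ℝ} {F : Finset (V × V)} (h : d.support ⊆ F) (v : V) :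
    div d v = ∑ e ∈ F with e.1 = v, d e - ∑ e ∈ F with e.2 = v, d e := by
  rw [div_apply]
  congr 1 <;>
    exact Finset.sum_subset (Finset.filter_subset_filter _ h) fun e he he' =>
      Finsupp.notMem_support_iff.1 fun hs =>
        he' (Finset.mem_filter.2 ⟨hs, (Finset.mem_filter.1 he).2⟩)

/-- A forest has at most as many edges as vertices, because the divergence is injective on it. -/
lemma Acyclic.card_le {F : Finset (V × V)} (h : Acyclic F) : F.card ≤ (endpoints F).card := by
  classical
  let L : Finsupp.supported ℝ ℝ (F : Set (V × V)) →ₗ[ℝ] (endpoints F → ℝ) :=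
    LinearMap.pi fun v => (Finsupp.lapply (v : V)).comp (div.comp (Submodule.subtype _))
  have hL : Function.Injective L := by
    rintro ⟨d, hd⟩ ⟨d', hd'⟩ hdd
    have hs : (d - d').support ⊆ F := fun a ha =>
      Finset.mem_coe.1 ((Finsupp.mem_supported ℝ (d - d')).1 (Submodule.sub_mem _ hd hd') ha)
    refine Subtype.ext (sub_eq_zero.1 (h (d - d') hs ?_))
    ext v
    by_cases hv : v ∈ endpoints F
    · have : div d v = div d' v := congrFun hdd ⟨v, hv⟩
      simp [this]
    · rw [div_apply_of_subset hs, Finset.filter_false_of_mem, Finset.filter_false_of_mem]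
      · simp
      · rintro e he rfl; exact hv (snd_mem_endpoints he)
      · rintro e he rfl; exact hv (fst_mem_endpoints he)
  have e := Finsupp.supportedEquivFinsupp (M := ℝ) (R := ℝ) (F : Set (V × V))
  have hL' : Function.Injective (L.comp e.symm.toLinearMap) := hL.comp e.symm.injective
  have := LinearMap.finrank_le_finrank_of_injective hL'
  simpa using this

/-- A forest whose vertices outside `T` all have degree at least three has at most `2 * #T` of
them. -/
lemma Acyclic.card_sdiff_le {F : Finset (V × V)} [DecidableEq V] (h : Acyclic F) (T : Finset V)
    (hdeg : ∀ v ∈ endpoints F \ T, 3 ≤ degree F v) : (endpoints F \ T).card ≤ 2 * T.card := by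
  have h1 : (endpoints F \ T).card * 3 ≤ ∑ v ∈ endpoints F \ T, degree F v := by
    simpa using Finset.card_nsmul_le_sum _ _ 3 hdeg
  have h2 : ∑ v ∈ endpoints F \ T, degree F v ≤ 2 * F.card := by
    rw [← sum_degree]
    exact Finset.sum_le_sum_of_subset Finset.sdiff_subset
  have h3 := h.card_le
  have h4 : (endpoints F).card ≤ (endpoints F \ T).card + T.card := by
    have := Finset.le_card_sdiff T (endpoints F)
    omega
  omega

end Counting

/-! ### Shortcuts -/

section Suppress

variable {V : Type*}

/-- The circulation which detours the segment `(u, w)` through `v`. -/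
noncomputable def detour (u v w : V) : V × V →₀ ℝ :=
  Finsupp.single (u, v) 1 + Finsupp.single (v, w) 1 - Finsupp.single (u, w) 1

lemma div_detour (u v w : V) : div (detour u v w) = 0 := by
  simp [detour]

lemma detour_apply_left {u v w : V} (huv : u ≠ v) (hvw : v ≠ w) : detour u v w (u, v) = 1 := by
  classical
  simp [detour, huv.symm, hvw.symm]

lemma detour_apply_right {u v w : V} (huv : u ≠ v) (hvw : v ≠ w) : detour u v w (v, w) = 1 := by
  classical
  simp [detour, huv, hvw]

lemma detour_apply_shortcut {u v w : V} (huv : u ≠ v) (hvw : v ≠ w) :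
    detour u v w (u, w) = -1 := by
  classical
  simp [detour, huv.symm, hvw]

lemma detour_apply_of_ne {u v w : V} {e : V × V} (h1 : e ≠ (u, v)) (h2 : e ≠ (v, w))
    (h3 : e ≠ (u, w)) : detour u v w e = 0 := by
  classical
  simp [detour, h1.symm, h2.symm, h3.symm]

end Suppress

/-! ### Routings and the removal of vertices of degree two -/

section Routing

variable {V C : Type*} [Fintype C]

/-- The total chain when the amount `q c` of each commodity `c` travels along the chain `τ c`. -/
noncomputable def load (q : C → ℝ≥0) (τ : C → V × V →₀ ℝ) : V × V →₀ ℝ := ∑ c, (q c : ℝ) • τ c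

lemma load_apply (q : C → ℝ≥0) (τ : C → V × V →₀ ℝ) (e : V × V) :
    load q τ e = ∑ c, (q c : ℝ) * τ c e := by
  simp [load, Finsupp.finsetSum_apply]

/-- `τ` carries each commodity `c` with `q c ≠ 0` from `src c` to `tgt c` inside `X`, as a unit
flow. -/
structure IsRouting (X : Set V) (q : C → ℝ≥0) (src tgt : C → V) (τ : C → V × V →₀ ℝ) : Prop where
  nonneg : ∀ c, 0 ≤ τ c
  mem : ∀ c e, τ c e ≠ 0 → e.1 ∈ X ∧ e.2 ∈ X
  div_eq : ∀ c, q c ≠ 0 → div (τ c) = Finsupp.single (src c) 1 - Finsupp.single (tgt c) 1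

/-- A routing along edge sets (coefficients `0` or `1`) whose total support is a forest. The chains
of unused commodities are set to zero, so that all chains are supported in that forest. -/
structure IsForestRouting (X : Set V) (q : C → ℝ≥0) (src tgt : C → V) (τ : C → V × V →₀ ℝ) : Prop
    extends IsRouting X q src tgt τ where
  binary : ∀ c e, τ c e = 0 ∨ τ c e = 1
  eq_zero : ∀ c, q c = 0 → τ c = 0
  acyclic : Acyclic (load q τ).support

variable {X : Set V} {q : C → ℝ≥0} {src tgt : C → V} {τ : C → V × V →₀ ℝ}

lemma load_nonneg (h : ∀ c, 0 ≤ τ c) : 0 ≤ load q τ := by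
  intro e
  rw [load_apply]
  exact Finset.sum_nonneg fun c _ => mul_nonneg (q c).2 (h c e)

lemma load_ne_zero (h : ∀ c, 0 ≤ τ c) {c : C} (hc : q c ≠ 0) {e : V × V} (he : τ c e ≠ 0) :
    load q τ e ≠ 0 := by
  rw [load_apply]
  refine (Finset.sum_pos' (fun c _ => mul_nonneg (q c).2 (h c e)) ⟨c, Finset.mem_univ _, ?_⟩).ne'
  exact mul_pos (NNReal.coe_pos.2 (pos_iff_ne_zero.2 hc))
    (lt_of_le_of_ne (h c e) (Ne.symm he))

lemma support_subset_load (h : ∀ c, 0 ≤ τ c) {c : C} (hc : q c ≠ 0) :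
    (τ c).support ⊆ (load q τ).support := fun _ he =>
  Finsupp.mem_support_iff.2 (load_ne_zero h hc (Finsupp.mem_support_iff.1 he))

lemma exists_ne_zero_of_load (e : V × V) (he : load q τ e ≠ 0) : ∃ c, q c ≠ 0 ∧ τ c e ≠ 0 := by
  rw [load_apply] at he
  obtain ⟨c, -, hc⟩ := Finset.exists_ne_zero_of_sum_ne_zero he
  exact ⟨c, fun h0 => hc (by simp [h0]), right_ne_zero_of_mul hc⟩

lemma IsRouting.div_load (h : IsRouting X q src tgt τ) :
    div (load q τ) =
      ∑ c, (Finsupp.single (src c) (q c : ℝ) - Finsupp.single (tgt c) (q c : ℝ)) := by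
  rw [load, map_sum]
  refine Finset.sum_congr rfl fun c _ => ?_
  by_cases hc : q c = 0
  · simp [hc]
  · rw [map_smul, h.div_eq c hc, smul_sub]; simp

variable [MetricSpace V]

/-- A vertex of degree at most two which is not a terminal can be bypassed: it has one arc `(u, v)`
in and one arc `(v, w)` out, with equal loads, and replacing these by `(u, w)` keeps the routing a
forest routing and lowers its cost, by the triangle inequality. -/
lemma IsForestRouting.exists_suppress (h : IsForestRouting X q src tgt τ) {α : ℝ}
    {v : V} (hsrc : ∀ c, src c ≠ v) (htgt : ∀ c, tgt c ≠ v)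
    (hv : v ∈ endpoints (load q τ).support) (hdeg : degree (load q τ).support v < 3) :
    ∃ τ', IsForestRouting X q src tgt τ' ∧
      (load q τ').support.card < (load q τ).support.card ∧
      chainCost α edgeLength (load q τ') ≤ chainCost α edgeLength (load q τ) := by
  classical
  set W := load q τ with hW
  set F := W.support with hF
  have hW0 : 0 ≤ W := load_nonneg h.nonneg
  have hτF : ∀ c, (τ c).support ⊆ F := fun c => by
    by_cases hc : q c = 0
    · simp [h.eq_zero c hc]
    · exact support_subset_load h.nonneg hc
  have hWpos : ∀ e ∈ F, 0 < W e := fun e he =>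
    lt_of_le_of_ne (hW0 e) (Finsupp.mem_support_iff.1 he).symm
  have hdivW : div W v = 0 := by
    rw [h.div_load, Finsupp.finsetSum_apply]
    refine Finset.sum_eq_zero fun c _ => ?_
    simp [hsrc c, htgt c]
  have hdivτ : ∀ c, div (τ c) v = 0 := fun c => by
    by_cases hc : q c = 0
    · simp [h.eq_zero c hc]
    · simp [h.div_eq c hc, hsrc c, htgt c]
  -- Conservation at `v` forces exactly one arc `(u, v)` into `v` and one arc `(v, w)` out of it.
  have hbal := hdivW
  rw [div_apply_of_subset (F := F) subset_rfl, sub_eq_zero] at hbal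
  have hone : ∃ u w, (F.filter fun e => e.1 = v) = {(v, w)} ∧
      (F.filter fun e => e.2 = v) = {(u, v)} := by
    have hpos1 : (F.filter fun e => e.1 = v).Nonempty ↔ (F.filter fun e => e.2 = v).Nonempty := by
      constructor
      · intro hne
        by_contra hno
        rw [Finset.not_nonempty_iff_eq_empty.1 hno, Finset.sum_empty] at hbal
        exact (Finset.sum_pos (fun e he => hWpos e (Finset.mem_filter.1 he).1) hne).ne' hbal
      · intro hne
        by_contra hno
        rw [Finset.not_nonempty_iff_eq_empty.1 hno, Finset.sum_empty] at hbal
        exact (Finset.sum_pos (fun e he => hWpos e (Finset.mem_filter.1 he).1) hne).ne hbal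
    have hne : (F.filter fun e => e.1 = v).Nonempty := by
      rcases Finset.mem_union.1 hv with hv | hv
      · obtain ⟨e, he, hev⟩ := Finset.mem_image.1 hv
        exact ⟨e, Finset.mem_filter.2 ⟨he, hev⟩⟩
      · obtain ⟨e, he, hev⟩ := Finset.mem_image.1 hv
        exact hpos1.2 ⟨e, Finset.mem_filter.2 ⟨he, hev⟩⟩
    have c1 := Finset.card_pos.2 hne
    have c2 := Finset.card_pos.2 (hpos1.1 hne)
    unfold degree at hdeg
    obtain ⟨⟨a, w⟩, ha⟩ := Finset.card_eq_one.1 (by omega : (F.filter fun e => e.1 = v).card = 1)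
    obtain ⟨⟨u, b⟩, hb⟩ := Finset.card_eq_one.1 (by omega : (F.filter fun e => e.2 = v).card = 1)
    have ha' : (a, w) ∈ F.filter fun e => e.1 = v := ha ▸ Finset.mem_singleton_self _
    have hb' : (u, b) ∈ F.filter fun e => e.2 = v := hb ▸ Finset.mem_singleton_self _
    obtain rfl : a = v := (Finset.mem_filter.1 ha').2
    obtain rfl : b = a := (Finset.mem_filter.1 hb').2
    exact ⟨u, w, ha, hb⟩
  obtain ⟨u, w, hout, hin⟩ := hone
  have hvwF : (v, w) ∈ F :=
    (Finset.mem_filter.1 (hout ▸ Finset.mem_singleton_self (v, w) :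
      (v, w) ∈ F.filter fun e => e.1 = v)).1
  have huvF : (u, v) ∈ F :=
    (Finset.mem_filter.1 (hin ▸ Finset.mem_singleton_self (u, v) :
      (u, v) ∈ F.filter fun e => e.2 = v)).1
  have hloop : ∀ a, (a, a) ∉ F := fun a ha => by
    have := h.acyclic (Finsupp.single (a, a) 1) (Finsupp.support_single_subset.trans
      (Finset.singleton_subset_iff.2 ha)) (by simp)
    simp at this
  have huv : u ≠ v := by rintro rfl; exact hloop _ huvF
  have hvw : v ≠ w := by rintro rfl; exact hloop _ hvwF
  have huwF : (u, w) ∉ F := fun huw => by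
    have := h.acyclic (detour u v w) (fun e he => ?_) (div_detour u v w)
    · have h2 := DFunLike.congr_fun this (u, v)
      rw [detour_apply_left huv hvw] at h2
      exact one_ne_zero h2
    · by_contra hne
      exact Finsupp.mem_support_iff.1 he (detour_apply_of_ne (by rintro rfl; exact hne huvF)
        (by rintro rfl; exact hne hvwF) (by rintro rfl; exact hne huw))
  -- Both arcs at `v` carry the same amount, of every commodity.
  have heq : ∀ d : V × V →₀ ℝ, d.support ⊆ F → div d v = 0 → d (v, w) = d (u, v) := by
    intro d hd h0
    rwa [div_apply_of_subset hd, hout, hin, Finset.sum_singleton, Finset.sum_singleton,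
      sub_eq_zero] at h0
  have h0F : ∀ d : V × V →₀ ℝ, d.support ⊆ F → ∀ e ∉ F, d e = 0 := fun d hd e he =>
    Finsupp.notMem_support_iff.1 fun hs => he (hd hs)
  let κ := detour u v w
  have e1 : (v, w) ≠ (u, v) := fun h => huv (congrArg Prod.fst h).symm
  have e2 : (u, w) ≠ (u, v) := fun h => hvw (congrArg Prod.snd h).symm
  have e3 : (u, w) ≠ (v, w) := fun h => huv (congrArg Prod.fst h)
  have hval : ∀ d : V × V →₀ ℝ, d.support ⊆ F → div d v = 0 → ∀ e, (d - d (u, v) • κ) e =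
      if e = (u, v) ∨ e = (v, w) then 0 else if e = (u, w) then d (u, v) else d e := by
    intro d hd h0 e
    rw [Finsupp.sub_apply, Finsupp.smul_apply, smul_eq_mul]
    by_cases h1 : e = (u, v)
    · subst h1; simp [κ, detour_apply_left huv hvw]
    by_cases h2 : e = (v, w)
    · subst h2; simp [κ, detour_apply_right huv hvw, heq d hd h0]
    by_cases h3 : e = (u, w)
    · subst h3
      simp [κ, detour_apply_shortcut huv hvw, h0F d hd _ huwF, e2, e3]
    · simp [κ, detour_apply_of_ne h1 h2 h3, h1, h2, h3]
  set τ' : C → V × V →₀ ℝ := fun c => τ c - τ c (u, v) • κ with hτ'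
  have hload : load q τ' = W - W (u, v) • κ := by
    ext e
    rw [load_apply, Finsupp.sub_apply, Finsupp.smul_apply, hW, load_apply, load_apply, smul_eq_mul,
      Finset.sum_mul, ← Finset.sum_sub_distrib]
    refine Finset.sum_congr rfl fun c _ => ?_
    simp [hτ', mul_sub, mul_assoc]
  have hWval := hval W subset_rfl hdivW
  rw [← hload] at hWval
  have hτval := fun c => hval (τ c) (hτF c) (hdivτ c)
  have hsupp : (load q τ').support ⊆ insert (u, w) ((F.erase (u, v)).erase (v, w)) := by
    intro e he
    rw [Finsupp.mem_support_iff, hWval] at he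
    by_cases h1 : e = (u, v)
    · simp [h1] at he
    by_cases h2 : e = (v, w)
    · simp [h2] at he
    by_cases h3 : e = (u, w)
    · simp [h3]
    · simp only [h1, h2, h3, or_self, if_false] at he
      simp [h1, h2, h3, hF, he]
  refine ⟨τ', ⟨⟨fun c e => ?_, fun c e he => ?_, fun c hc => ?_⟩, fun c e => ?_, fun c hc => ?_,
    fun d hd hd0 => ?_⟩, ?_, ?_⟩
  · simp only [hτ', hτval]
    split_ifs
    · exact le_rfl
    · exact h.nonneg c (u, v)
    · exact h.nonneg c e
  · simp only [hτ', hτval] at he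
    have hmem : ∀ e ∈ F, e.1 ∈ X ∧ e.2 ∈ X := fun e he => by
      obtain ⟨c, -, hc⟩ := exists_ne_zero_of_load e (Finsupp.mem_support_iff.1 he)
      exact h.mem c e hc
    split_ifs at he with h1 h2
    · exact absurd rfl he
    · subst h2; exact ⟨(hmem _ huvF).1, (hmem _ hvwF).2⟩
    · exact h.mem c e he
  · simp only [hτ', map_sub, map_smul, κ, div_detour, smul_zero, sub_zero]
    exact h.div_eq c hc
  · simp only [hτ', hτval]
    split_ifs
    · exact Or.inl rfl
    · exact h.binary c _
    · exact h.binary c _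
  · simp [hτ', h.eq_zero c hc]
  · have hd' : ∀ e, e ∉ insert (u, w) ((F.erase (u, v)).erase (v, w)) → d e = 0 := fun e he =>
      Finsupp.notMem_support_iff.1 fun hs => he (hsupp (hd hs))
    have key := h.acyclic (d + d (u, w) • κ) (fun e he => ?_) (by simp [hd0, κ, div_detour])
    · have h2 := DFunLike.congr_fun key (u, v)
      simp only [Finsupp.add_apply, Finsupp.smul_apply, κ, detour_apply_left huv hvw, smul_eq_mul,
        mul_one, Finsupp.coe_zero, Pi.zero_apply] at h2
      rw [hd' (u, v) (by simp [e2.symm]), zero_add] at h2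
      simpa [h2] using key
    · by_contra hne
      refine Finsupp.mem_support_iff.1 he ?_
      have h1 : e ≠ (u, v) := by rintro rfl; exact hne huvF
      have h2 : e ≠ (v, w) := by rintro rfl; exact hne hvwF
      by_cases h3 : e = (u, w)
      · subst h3; simp [κ, detour_apply_shortcut huv hvw]
      · simp only [Finsupp.add_apply, Finsupp.smul_apply, κ, detour_apply_of_ne h1 h2 h3]
        rw [hd' e (by simp [h3, show e ∉ F from hne])]; simp
  · refine (Finset.card_le_card hsupp).trans_lt ?_
    have c1 := Finset.card_erase_of_mem huvF
    have c2 := Finset.card_erase_of_mem (Finset.mem_erase.2 ⟨e1, hvwF⟩)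
    have c3 := Finset.card_insert_le (u, w) ((F.erase (u, v)).erase (v, w))
    have c4 : 1 < F.card := Finset.one_lt_card.2 ⟨_, huvF, _, hvwF, e1.symm⟩
    omega
  · have hW3 : F = insert (u, v) (insert (v, w) ((F.erase (u, v)).erase (v, w))) := by
      rw [Finset.insert_erase (Finset.mem_erase.2 ⟨e1, hvwF⟩), Finset.insert_erase huvF]
    rw [chainCost_eq_sum hsupp, chainCost_eq_sum (W := W) hW3.le,
      Finset.sum_insert (by simp [huwF]), Finset.sum_insert (by simp [huv]),
      Finset.sum_insert (by simp)]
    have hrest : ∑ e ∈ (F.erase (u, v)).erase (v, w), massCost α (load q τ' e) * edgeLength e =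
        ∑ e ∈ (F.erase (u, v)).erase (v, w), massCost α (W e) * edgeLength e := by
      refine Finset.sum_congr rfl fun e he => ?_
      simp only [Finset.mem_erase] at he
      have h3 : e ≠ (u, w) := by rintro rfl; exact huwF he.2.2
      rw [hWval]; simp [he.1, he.2.1, h3]
    rw [hrest, hWval (u, w), heq W subset_rfl hdivW]
    simp only [e2, e3, or_self, if_false, if_true]
    have htri : edgeLength (u, w) ≤ edgeLength (u, v) + edgeLength (v, w) := dist_triangle u v w
    have := mul_le_mul_of_nonneg_left htri (massCost_nonneg (α := α) (hW0 (u, v)))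
    linarith

/-- Bypassing vertices as long as possible leaves degree at least three at all nonterminal vertices,
hence a number of them that is bounded in terms of the number of terminals. -/
lemma IsForestRouting.exists_three_le_degree (h : IsForestRouting X q src tgt τ) (α : ℝ)
    {T : Finset V} (hsrc : ∀ c, src c ∈ T) (htgt : ∀ c, tgt c ∈ T) :
    ∃ τ', IsForestRouting X q src tgt τ' ∧
      chainCost α edgeLength (load q τ') ≤ chainCost α edgeLength (load q τ) ∧
      ∀ v ∈ endpoints (load q τ').support, v ∉ T → 3 ≤ degree (load q τ').support v := by
  induction hn : (load q τ).support.card using Nat.strong_induction_on generalizing τ with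
  | _ n ih =>
    by_cases hdeg : ∀ v ∈ endpoints (load q τ).support, v ∉ T → 3 ≤ degree (load q τ).support v
    · exact ⟨τ, h, le_rfl, hdeg⟩
    · push Not at hdeg
      obtain ⟨v, hv, hvT, hlt⟩ := hdeg
      obtain ⟨τ₁, h₁, hc, hle⟩ := h.exists_suppress (α := α)
        (fun c hc => hvT (by rw [← hc]; exact hsrc c))
        (fun c hc => hvT (by rw [← hc]; exact htgt c)) hv hlt
      obtain ⟨τ', h', hle', hd⟩ := ih _ (hn ▸ hc) h₁ rfl
      exact ⟨τ', h', hle'.trans hle, hd⟩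

end Routing

/-! ### Existence of optimal routings -/

section Existence

variable {V C : Type*}

/-- The chain with coefficient one on each edge in `s`. -/
noncomputable def edgeChain (s : Finset (V × V)) : V × V →₀ ℝ := ∑ e ∈ s, Finsupp.single e 1

lemma edgeChain_apply [DecidableEq V] (s : Finset (V × V)) (e : V × V) :
    edgeChain s e = if e ∈ s then 1 else 0 := by
  simp [edgeChain, Finsupp.finsetSum_apply, Finsupp.single_apply]

lemma edgeChain_nonneg (s : Finset (V × V)) : 0 ≤ edgeChain s :=
  Finset.sum_nonneg fun _ _ => Finsupp.single_nonneg.2 zero_le_one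

lemma edgeChain_support {d : V × V →₀ ℝ} (hd : ∀ e, d e = 0 ∨ d e = 1) :
    edgeChain d.support = d := by
  classical
  ext e
  rw [edgeChain_apply]
  rcases hd e with h | h <;> simp [h]

lemma binary_mapDomain {A B : Type*} {d : A →₀ ℝ} (hd : ∀ a, d a = 0 ∨ d a = 1) {φ : A → B}
    (hφ : Set.InjOn φ d.support) (b : B) : d.mapDomain φ b = 0 ∨ d.mapDomain φ b = 1 := by
  classical
  by_cases hb : b ∈ (d.mapDomain φ).support
  · obtain ⟨a, ha, rfl⟩ := Finset.mem_image.1 (Finsupp.mapDomain_support hb)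
    rw [Finsupp.mapDomain_apply' _ d subset_rfl hφ (Finset.mem_coe.2 ha)]
    exact hd a
  · exact Or.inl (Finsupp.notMem_support_iff.1 hb)

variable [Fintype C]

lemma mapDomain_load {U : Type*} (q : C → ℝ≥0) (τ : C → V × V →₀ ℝ) (Φ : V × V → U × U) :
    (load q τ).mapDomain Φ = load q fun c => (τ c).mapDomain Φ := by
  rw [load, Finsupp.mapDomain_finsetSum]
  exact Finset.sum_congr rfl fun c _ => Finsupp.mapDomain_smul _ _

/-- Some routing costs no more than any forest routing. A forest routing may be assumed to have at
most `2 * #T` vertices besides the set `T` of terminals, so it is given by one of finitely many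
abstract routings on `T ⊕ Fin N` together with a position in the compact set `X` for each slot in
`Fin N`. The cost is continuous in the positions. As vertices may collide in the minimum, the minimizer need not
be a forest routing. -/
theorem exists_optimal_routing [MetricSpace V] {X : Set V} (hX : IsCompact X) (hne : X.Nonempty)
    {α : ℝ} (hα : 0 ≤ α) (hα1 : α < 1) (q : C → ℝ≥0) {src tgt : C → V} (hsrc : ∀ c, src c ∈ X)
    (htgt : ∀ c, tgt c ∈ X) :
    ∃ τ, IsRouting X q src tgt τ ∧ (∀ c v, τ c (v, v) = 0) ∧
      ∀ τ', IsForestRouting X q src tgt τ' →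
        chainCost α edgeLength (load q τ) ≤ chainCost α edgeLength (load q τ') := by
  classical
  let T : Finset V := Finset.univ.image src ∪ Finset.univ.image tgt
  have hsT : ∀ c, src c ∈ T := fun c =>
    Finset.mem_union_left _ (Finset.mem_image_of_mem _ (Finset.mem_univ c))
  have htT : ∀ c, tgt c ∈ T := fun c =>
    Finset.mem_union_right _ (Finset.mem_image_of_mem _ (Finset.mem_univ c))
  have hTX : ∀ v ∈ T, v ∈ X := by
    intro v hv
    rcases Finset.mem_union.1 hv with hv | hv <;> obtain ⟨c, -, rfl⟩ := Finset.mem_image.1 hv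
    exacts [hsrc c, htgt c]
  let N := 2 * T.card + 1
  let pos : (Fin N → V) → T ⊕ Fin N → V := fun p => Sum.elim (fun v => (v : V)) p
  let K : Set (Fin N → V) := Set.univ.pi fun _ => X
  have hK : IsCompact K := isCompact_univ_pi fun _ => hX
  have hKne : K.Nonempty := ⟨fun _ => hne.some, fun _ _ => hne.some_mem⟩
  have hpos : ∀ p ∈ K, ∀ i, pos p i ∈ X := by
    rintro p hp (v | i)
    exacts [hTX v v.2, hp i trivial]
  let len : (Fin N → V) → (T ⊕ Fin N) × (T ⊕ Fin N) → ℝ := fun p =>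
    edgeLength ∘ Prod.map (pos p) (pos p)
  have hlen : ∀ p e, 0 ≤ len p e := fun p e => edgeLength_nonneg _
  let cost : (C → Finset ((T ⊕ Fin N) × (T ⊕ Fin N))) → (Fin N → V) → ℝ := fun h p =>
    chainCost α (len p) (load q fun c => edgeChain (h c))
  have hcont : ∀ h, Continuous (cost h) := by
    intro h
    have hposc : ∀ i, Continuous fun p => pos p i := by
      rintro (v | i)
      exacts [continuous_const, continuous_apply i]
    exact continuous_finsetSum _ fun e _ =>
      continuous_const.mul ((hposc e.1).dist (hposc e.2))
  choose P hPK hPmin using fun h => hK.exists_isMinOn hKne (hcont h).continuousOn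
  let valid : Set (C → Finset ((T ⊕ Fin N) × (T ⊕ Fin N))) := {h | ∀ c, q c ≠ 0 →
    div (edgeChain (h c)) = Finsupp.single (Sum.inl ⟨src c, hsT c⟩) 1 -
      Finsupp.single (Sum.inl ⟨tgt c, htT c⟩) 1}
  obtain ⟨h, hv, hmin⟩ := Set.exists_min_image valid (fun h => cost h (P h)) (Set.toFinite _)
    ⟨fun c => {(Sum.inl ⟨src c, hsT c⟩, Sum.inl ⟨tgt c, htT c⟩)}, fun c _ => by simp [edgeChain]⟩
  let Φ := Prod.map (pos (P h)) (pos (P h))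
  let σ : C → V × V →₀ ℝ := fun c => (edgeChain (h c)).mapDomain Φ
  let off : V × V → Prop := fun e => e.1 ≠ e.2
  have hσ : ∀ c, 0 ≤ σ c := fun c => mapDomain_nonneg _ (edgeChain_nonneg _)
  have hload : load q (fun c => (σ c).filter off) = (load q σ).filter off := by
    ext e
    by_cases he : off e <;> simp [load_apply, he]
  refine ⟨fun c => (σ c).filter off, ⟨fun c e => ?_, fun c e he => ?_, fun c hc => ?_⟩,
    fun c v => by simp [off], fun τ' hτ' => ?_⟩
  · by_cases he : off e
    · simpa [he] using hσ c e
    · simp [he]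
  · have he' : e ∈ (σ c).support := by
      by_contra hno
      have h0 := Finsupp.notMem_support_iff.1 hno
      by_cases ho : off e <;> simp [ho, h0] at he
    obtain ⟨a, -, rfl⟩ := Finset.mem_image.1 (Finsupp.mapDomain_support he')
    exact ⟨hpos _ (hPK h) _, hpos _ (hPK h) _⟩
  · rw [div_filter_offDiag, div_mapDomain, hv c hc, sub_eq_add_neg, Finsupp.mapDomain_add,
      ← Finsupp.single_neg, Finsupp.mapDomain_single, Finsupp.mapDomain_single, Finsupp.single_neg,
      ← sub_eq_add_neg]
    rfl
  · obtain ⟨τ, hτ, hle, hdeg⟩ := hτ'.exists_three_le_degree α hsT htT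
    set F := (load q τ).support with hF
    have hcard : (endpoints F \ T).card < N := by
      exact Nat.lt_succ_of_le (hτ.acyclic.card_sdiff_le T fun v hv =>
        hdeg v (Finset.mem_sdiff.1 hv).1 (Finset.mem_sdiff.1 hv).2)
    have hFX : ∀ v ∈ endpoints F, v ∈ X := by
      intro v hv
      rcases Finset.mem_union.1 hv with hv | hv <;>
        (obtain ⟨e, he, rfl⟩ := Finset.mem_image.1 hv
         obtain ⟨c, -, hc⟩ := exists_ne_zero_of_load e (Finsupp.mem_support_iff.1 he))
      exacts [(hτ.mem c e hc).1, (hτ.mem c e hc).2]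
    -- Number the branching points, and place all unused slots at some point of `X`.
    let ψ := (endpoints F \ T).equivFin
    let φ : V → T ⊕ Fin N := fun v =>
      if hT : v ∈ T then Sum.inl ⟨v, hT⟩
      else if hS : v ∈ endpoints F \ T then Sum.inr ((ψ ⟨v, hS⟩).castLE hcard.le)
      else Sum.inr ⟨0, Nat.succ_pos _⟩
    let p : Fin N → V := fun i =>
      if hi : (i : ℕ) < (endpoints F \ T).card then ψ.symm ⟨i, hi⟩ else hne.some
    have hpK : p ∈ K := by
      intro i _
      by_cases hi : (i : ℕ) < (endpoints F \ T).card
      · simp only [p, hi, dif_pos]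
        exact hFX _ (Finset.mem_sdiff.1 (ψ.symm ⟨i, hi⟩).2).1
      · simp only [p, hi, dif_neg, not_false_eq_true]
        exact hne.some_mem
    have hφT : ∀ v (hv : v ∈ T), φ v = Sum.inl ⟨v, hv⟩ := fun v hv => by simp [φ, hv]
    have hφ : ∀ v ∈ endpoints F, pos p (φ v) = v := by
      intro v hv
      by_cases hT : v ∈ T
      · rw [hφT v hT]; rfl
      · have hS : v ∈ endpoints F \ T := Finset.mem_sdiff.2 ⟨hv, hT⟩
        simp only [φ, hT, hS, dif_neg, dif_pos, not_false_eq_true, pos, Sum.elim_inr, p]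
        simp
    have hΦ : ∀ e ∈ F, Prod.map (pos p) (pos p) (Prod.map φ φ e) = e := fun e he =>
      Prod.ext (hφ _ (fst_mem_endpoints he)) (hφ _ (snd_mem_endpoints he))
    have hinj : Set.InjOn (Prod.map φ φ) (F : Set (V × V)) := fun a ha b hb hab => by
      rw [← hΦ a ha, ← hΦ b hb, hab]
    have hτF : ∀ c, (τ c).support ⊆ F := fun c => by
      by_cases hc : q c = 0
      · simp [hτ.eq_zero c hc]
      · exact support_subset_load hτ.nonneg hc
    let h' : C → Finset ((T ⊕ Fin N) × (T ⊕ Fin N)) := fun c =>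
      ((τ c).mapDomain (Prod.map φ φ)).support
    have hh' : ∀ c, edgeChain (h' c) = (τ c).mapDomain (Prod.map φ φ) := fun c =>
      edgeChain_support (binary_mapDomain (hτ.binary c) (hinj.mono (hτF c)))
    have hval : h' ∈ valid := by
      intro c hc
      rw [hh', div_mapDomain, hτ.div_eq c hc, sub_eq_add_neg, Finsupp.mapDomain_add,
        ← Finsupp.single_neg, Finsupp.mapDomain_single, Finsupp.mapDomain_single,
        hφT _ (hsT c), hφT _ (htT c), Finsupp.single_neg, ← sub_eq_add_neg]
    have hcost' : cost h' p ≤ chainCost α edgeLength (load q τ) := by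
      have h1 : (load q fun c => edgeChain (h' c)) = (load q τ).mapDomain (Prod.map φ φ) := by
        rw [mapDomain_load]; simp only [hh']
      change chainCost α (len p) _ ≤ _
      rw [h1]
      refine (chainCost_mapDomain_le hα hα1 (hlen p) (load_nonneg hτ.nonneg) _).trans ?_
      rw [chainCost_eq_sum (s := F) subset_rfl, chainCost_eq_sum (s := F) subset_rfl]
      refine Finset.sum_le_sum fun e he => ?_
      simp only [Function.comp_apply, len, hΦ e he, le_refl]
    have hcost : chainCost α edgeLength (load q fun c => (σ c).filter off) ≤ cost h (P h) := by
      rw [hload]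
      refine (chainCost_filter_le edgeLength_nonneg (load_nonneg hσ) _).trans ?_
      simp only [σ]
      rw [← mapDomain_load]
      exact chainCost_mapDomain_le hα hα1 edgeLength_nonneg
        (load_nonneg fun c => edgeChain_nonneg _) _
    calc _ ≤ cost h (P h) := hcost
      _ ≤ cost h' (P h') := hmin h' hval
      _ ≤ cost h' p := hPmin h' hpK
      _ ≤ _ := hcost'
      _ ≤ _ := hle

end Existence

/-! ### Minimal flows -/

section MinimalFlow

variable {V ι κ C : Type*} [Fintype κ] [Fintype C]

lemma IsRouting.isFlow {X : Set V} {q : C → ℝ≥0} {src tgt : C → V} {τ : C → V × V →₀ ℝ}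
    (h : IsRouting X q src tgt τ) (hloop : ∀ c v, τ c (v, v) = 0) {x : ι → V} {b : V →₀ ℝ}
    (hsrc : ∀ c, src c ∈ Set.range x) (hb : b = ∑ c, Finsupp.single (tgt c) (q c : ℝ)) :
    IsFlow X x b (load q τ) := by
  have hex : ∀ v, div (load q τ) v + b v = ∑ c, Finsupp.single (src c) (q c : ℝ) v := by
    intro v
    rw [h.div_load, hb, Finset.sum_sub_distrib, ← Finsupp.add_apply, sub_add_cancel,
      Finsupp.finsetSum_apply]
  refine ⟨load_nonneg h.nonneg, fun v => by simp [load_apply, hloop], fun e he => ?_, fun v => ?_,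
    fun v hv => ?_⟩
  · obtain ⟨c, -, hc⟩ := exists_ne_zero_of_load e he
    exact h.mem c e hc
  · rw [hex]
    exact Finset.sum_nonneg fun c _ => Finsupp.single_nonneg.2 (q c).2 v
  · rw [hex]
    exact Finset.sum_eq_zero fun c _ => Finsupp.single_eq_of_ne fun hvc => hv (hvc ▸ hsrc c)

/-- Curves in a forest which superpose to `W` form a forest routing with load `W`. -/
lemma exists_forestRouting_of_curves {X : Set V} {q : C → ℝ≥0} {src tgt : C → V} {W : V × V →₀ ℝ}
    (hX : ∀ e, W e ≠ 0 → e.1 ∈ X ∧ e.2 ∈ X) (hac : Acyclic W.support) {g : C → List V}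
    (hg : ∀ c, q c ≠ 0 → (g c).head? = some (src c) ∧ (g c).getLast? = some (tgt c) ∧
      (g c).Nodup ∧ (g c).IsChain (Arc W))
    (hW : W = ∑ c, (q c : ℝ) • toReal (curveChain (g c))) :
    ∃ τ, IsForestRouting X q src tgt τ ∧ load q τ = W := by
  classical
  set τ : C → V × V →₀ ℝ := fun c => if q c = 0 then 0 else toReal (curveChain (g c)) with hτ
  have hload : load q τ = W := by
    rw [hW, load]
    refine Finset.sum_congr rfl fun c _ => ?_
    by_cases hc : q c = 0 <;> simp [hτ, hc]
  refine ⟨τ, ⟨⟨fun c => ?_, fun c e he => ?_, fun c hc => ?_⟩, fun c e => ?_, fun c hc => ?_,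
    hload ▸ hac⟩, hload⟩
  · by_cases hc : q c = 0
    · simp [hτ, hc]
    · simpa [hτ, hc] using toReal_nonneg _
  · by_cases hc : q c = 0
    · simp [hτ, hc] at he
    · refine hX e (rel_of_curveChain_ne_zero (hg c hc).2.2.2 ?_)
      simpa [hτ, hc] using he
  · simp only [hτ, hc, if_false]
    exact div_curveChain (hg c hc).1 (hg c hc).2.1 (hg c hc).2.2.1
  · by_cases hc : q c = 0
    · simp [hτ, hc]
    · simp only [hτ, hc, if_false, toReal_apply, curveChain_apply]
      split_ifs <;> simp
  · simp [hτ, hc]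

variable [MetricSpace V]

/-- A flow of least cost among all flows with the given sources and demand. -/
def IsMinFlow (α : ℝ) (X : Set V) (x : ι → V) (b : V →₀ ℝ) (W : V × V →₀ ℝ) : Prop :=
  IsFlow X x b W ∧ ∀ W', IsFlow X x b W' → chainCost α edgeLength W ≤ chainCost α edgeLength W'

lemma IsMinFlow.isReduced {α : ℝ} (hα : 0 ≤ α) (hα1 : α < 1) {X : Set V} {x : ι → V} {b : V →₀ ℝ}
    (hb : 0 ≤ b) {W : V × V →₀ ℝ} (h : IsMinFlow α X x b W) : IsReduced x W := by
  by_contra hred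
  obtain ⟨W', hW', -, hlt⟩ := h.1.exists_lt_of_not_isReduced hb hα hα1 hred
  exact (h.2 W' hW').not_gt hlt

/-- A flow of least cost exists, and it can be chosen such that each household is served by one
factory. It is the cheapest among the optimal routings for the finitely many assignment maps `S`:
every flow costs at least as much as some reduced flow, which is a forest routing for some `S`. -/
theorem exists_isMinFlow [Finite ι] [Nonempty ι] {α : ℝ} (hα : 0 ≤ α) (hα1 : α < 1) {X : Set V}
    (hX : IsCompact X) {x : ι → V} (hx : ∀ i, x i ∈ X) {y : κ → V} (hy : ∀ j, y j ∈ X)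
    (n : κ → ℝ≥0) :
    ∃ (S : κ → ι) (τ : κ → V × V →₀ ℝ), IsRouting X n (x ∘ S) y τ ∧
      IsMinFlow α X x (demand y n) (load n τ) := by
  classical
  choose τ hτ hloop hmin using fun S : κ → ι =>
    exists_optimal_routing hX ⟨_, hx (Classical.arbitrary ι)⟩ hα hα1 n (src := x ∘ S) (tgt := y)
      (fun j => hx (S j)) hy
  obtain ⟨S, hS⟩ := Finite.exists_min fun S => chainCost α edgeLength (load n (τ S))
  refine ⟨S, τ S, hτ S, (hτ S).isFlow (hloop S) (fun j => ⟨S j, rfl⟩) (demand_eq_sum y n),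
    fun W' hW' => ?_⟩
  obtain ⟨W, hW, hred, hle⟩ := hW'.exists_isReduced (demand_nonneg y n) hα hα1
  obtain ⟨S', g, hg, hWg⟩ := hW.exists_curves hred.rigid
  obtain ⟨σ, hσ, hload⟩ := exists_forestRouting_of_curves (src := x ∘ S') hW.mem
    hred.rigid.acyclic hg hWg
  exact ((hS S').trans (hload ▸ hmin S' σ hσ)).trans hle

end MinimalFlow

/-! ### Transport paths as flows -/

section Graphs

variable {V : Type*}

lemma support_toReal_weight (G : WeightedGraph V) : (toReal G.weight).support = G.edges :=
  support_toReal _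

lemma arc_toReal_iff {G : WeightedGraph V} {u v : V} :
    Arc (toReal G.weight) u v ↔ (u, v) ∈ G.edges := by
  rw [← support_toReal_weight, Finsupp.mem_support_iff]; rfl

lemma div_toReal_weight (G : WeightedGraph V) (v : V) :
    div (toReal G.weight) v = (G.outflow v : ℝ) - G.inflow v := by
  classical
  rw [div_apply_of_subset (support_toReal_weight G).le, WeightedGraph.outflow,
    WeightedGraph.inflow, NNReal.coe_sum, NNReal.coe_sum]
  rfl

lemma coe_cost [MetricSpace V] (G : WeightedGraph V) (α : ℝ) :
    (G.cost α : ℝ) = chainCost α edgeLength (toReal G.weight) := by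
  rw [chainCost_eq_sum (support_toReal_weight G).le, WeightedGraph.cost, NNReal.coe_sum]
  refine Finset.sum_congr rfl fun e he => ?_
  have : (toReal G.weight) e ≠ 0 := by
    rw [← support_toReal_weight] at he
    exact Finsupp.mem_support_iff.1 he
  rw [massCost_of_ne this, NNReal.coe_mul, NNReal.coe_rpow]
  rfl

lemma IsTransportPath.div_eq {X : Set V} {a b : AtomicMeasure V} {G : WeightedGraph V}
    (h : IsTransportPath X a b G) : div (toReal G.weight) = toReal a - toReal b := by
  classical
  ext v
  rw [div_toReal_weight, Finsupp.sub_apply, toReal_apply, toReal_apply]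
  by_cases hv : v ∈ G.verts
  · have := congrArg (fun r : ℝ≥0 => (r : ℝ)) (h.balance v hv)
    simp only [NNReal.coe_add] at this
    linarith
  · have ha : a v = 0 := Finsupp.notMem_support_iff.1 fun hs => hv (h.source_mem v hs)
    have hb : b v = 0 := Finsupp.notMem_support_iff.1 fun hs => hv (h.target_mem v hs)
    have ho : G.outflow v = 0 := Finset.sum_eq_zero fun e he => absurd
      ((Finset.mem_filter.1 he).2 ▸ (G.mem_verts e (Finset.mem_filter.1 he).1).1) hv
    have hi : G.inflow v = 0 := Finset.sum_eq_zero fun e he => absurd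
      ((Finset.mem_filter.1 he).2 ▸ (G.mem_verts e (Finset.mem_filter.1 he).1).2) hv
    simp [ha, hb, ho, hi]

lemma IsTransportPath.of_div_eq {X : Set V} {a b : AtomicMeasure V} {G : WeightedGraph V}
    (hX : ∀ v ∈ G.verts, v ∈ X) (ha : ∀ v ∈ a.support, v ∈ G.verts)
    (hb : ∀ v ∈ b.support, v ∈ G.verts) (hdiv : div (toReal G.weight) = toReal a - toReal b)
    (hac : Acyclic (toReal G.weight).support) : IsTransportPath X a b G := by
  refine ⟨hX, ha, hb, fun v _ => ?_, noCycles_of_acyclic (support_toReal_weight G ▸ hac)⟩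
  have h1 := DFunLike.congr_fun hdiv v
  rw [div_toReal_weight, Finsupp.sub_apply, toReal_apply, toReal_apply] at h1
  apply NNReal.coe_injective
  push_cast
  linarith

lemma IsTransportPath.acyclic {X : Set V} {a b : AtomicMeasure V} {G : WeightedGraph V}
    (h : IsTransportPath X a b G) : Acyclic (toReal G.weight).support :=
  support_toReal_weight G ▸ acyclic_of_noCycles h.noCycles

lemma IsTransportPath.isFlow {ι : Type*} {X : Set V} {a b : AtomicMeasure V} {G : WeightedGraph V}
    (h : IsTransportPath X a b G) {x : ι → V} (ha : ∀ v, v ∉ Set.range x → a v = 0) :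
    IsFlow X x (toReal b) (toReal G.weight) := by
  have hex : ∀ v, div (toReal G.weight) v + toReal b v = a v := fun v => by
    rw [h.div_eq, Finsupp.sub_apply, sub_add_cancel, toReal_apply]
  refine ⟨toReal_nonneg _, fun v => ?_, fun e he => ?_, fun v => ?_, fun v hv => ?_⟩
  · by_contra hne
    have : (v, v) ∈ G.edges := arc_toReal_iff.1 hne
    exact h.noCycles.1 v v this this
  · have := G.mem_verts e (by rw [← support_toReal]; exact Finsupp.mem_support_iff.2 he)
    exact ⟨h.verts_subset _ this.1, h.verts_subset _ this.2⟩
  · rw [hex]; exact (a v).2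
  · rw [hex, ha v hv]; rfl

lemma exists_graph {W : V × V →₀ ℝ} (hW : 0 ≤ W) (Vt : Finset V)
    (hVt : ∀ e, W e ≠ 0 → e.1 ∈ Vt ∧ e.2 ∈ Vt) :
    ∃ G : WeightedGraph V, G.verts = Vt ∧ toReal G.weight = W := by
  refine ⟨⟨Vt, W.mapRange Real.toNNReal Real.toNNReal_zero, fun e he =>
    hVt e fun h0 => ?_⟩, rfl, ?_⟩
  · simp [h0] at he
  · ext e; simpa using hW e

lemma exists_transportPath {X : Set V} {a b : AtomicMeasure V} {W : V × V →₀ ℝ} (hW : 0 ≤ W)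
    (hX : ∀ e, W e ≠ 0 → e.1 ∈ X ∧ e.2 ∈ X) (ha : ∀ v ∈ a.support, v ∈ X)
    (hb : ∀ v ∈ b.support, v ∈ X) (hdiv : div W = toReal a - toReal b)
    (hac : Acyclic W.support) :
    ∃ G, IsTransportPath X a b G ∧ toReal G.weight = W := by
  classical
  obtain ⟨G, hV, rfl⟩ := exists_graph hW (a.support ∪ b.support ∪ endpoints W.support)
    fun e he => ⟨Finset.mem_union_right _ (fst_mem_endpoints (Finsupp.mem_support_iff.2 he)),
      Finset.mem_union_right _ (snd_mem_endpoints (Finsupp.mem_support_iff.2 he))⟩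
  refine ⟨G, .of_div_eq (fun v hv => ?_) (fun v hv => ?_) (fun v hv => ?_) hdiv hac, rfl⟩
  · rw [hV] at hv
    rcases Finset.mem_union.1 hv with hv | hv
    · rcases Finset.mem_union.1 hv with hv | hv
      exacts [ha v hv, hb v hv]
    · rcases Finset.mem_union.1 hv with hv | hv <;>
        obtain ⟨e, he, rfl⟩ := Finset.mem_image.1 hv
      exacts [(hX e (Finsupp.mem_support_iff.1 he)).1, (hX e (Finsupp.mem_support_iff.1 he)).2]
  · rw [hV]; exact Finset.mem_union_left _ (Finset.mem_union_left _ hv)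
  · rw [hV]; exact Finset.mem_union_left _ (Finset.mem_union_right _ hv)

lemma mem_verts_of_isChain {G : WeightedGraph V} {p : List V} {b : V}
    (hp : p.IsChain (Arc (toReal G.weight))) (hb : p.getLast? = some b) (hbG : b ∈ G.verts) :
    ∀ z ∈ p, z ∈ G.verts := by
  induction p with
  | nil => simp
  | cons a t ih =>
    cases t with
    | nil =>
      obtain rfl : a = b := by simpa using hb
      simpa using hbG
    | cons c t =>
      rw [List.isChain_cons_cons] at hp
      intro z hz
      rcases List.mem_cons.1 hz with rfl | hz
      · exact (G.mem_verts _ (arc_toReal_iff.1 hp.1)).1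
      · exact ih hp.2 (by simpa using hb) z hz

end Graphs

/-! ### Sums of flows -/

section Sums

variable {V ι κ : Type*} [Fintype ι]

lemma IsFlow.sum {X : Set V} {x : κ → V} {b : ι → V →₀ ℝ} {W : ι → V × V →₀ ℝ}
    (h : ∀ i, IsFlow X x (b i) (W i)) : IsFlow X x (∑ i, b i) (∑ i, W i) := by
  have hex : ∀ v, div (∑ i, W i) v + (∑ i, b i) v = ∑ i, (div (W i) v + b i v) := fun v => by
    rw [map_sum, Finsupp.finsetSum_apply, Finsupp.finsetSum_apply, Finset.sum_add_distrib]
  refine ⟨Finset.sum_nonneg fun i _ => (h i).nonneg, fun v => ?_, fun e he => ?_, fun v => ?_,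
    fun v hv => ?_⟩
  · rw [Finsupp.finsetSum_apply]
    exact Finset.sum_eq_zero fun i _ => (h i).loopless v
  · rw [Finsupp.finsetSum_apply] at he
    obtain ⟨i, -, hi⟩ := Finset.exists_ne_zero_of_sum_ne_zero he
    exact (h i).mem e hi
  · rw [hex]; exact Finset.sum_nonneg fun i _ => (h i).excess_nonneg v
  · rw [hex]; exact Finset.sum_eq_zero fun i _ => (h i).excess_eq_zero v hv

lemma toReal_weight_sum (G : ι → WeightedGraph V) :
    toReal (WeightedGraph.sum G).weight = ∑ i, toReal (G i).weight := toReal_sum _ _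

lemma coe_cost_sum_le [MetricSpace V] {α : ℝ} (hα : 0 ≤ α) (hα1 : α < 1)
    (G : ι → WeightedGraph V) : (WeightedGraph.sum G).cost α ≤ ∑ i, (G i).cost α := by
  rw [← NNReal.coe_le_coe, coe_cost, toReal_weight_sum, NNReal.coe_sum]
  simp only [coe_cost]
  exact chainCost_sum_le hα hα1 edgeLength_nonneg _ _ fun i => toReal_nonneg _

lemma chainCost_sum_of_disjoint {α : ℝ} {len : V × V → ℝ} {W : ι → V × V →₀ ℝ}
    (hW : ∀ i, 0 ≤ W i) (hdis : ∀ e i i', W i e ≠ 0 → W i' e ≠ 0 → i = i') :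
    chainCost α len (∑ i, W i) = ∑ i, chainCost α len (W i) := by
  have hsub : ∀ i, (W i).support ⊆ (∑ i, W i).support := fun i e he => by
    rw [Finsupp.mem_support_iff, Finsupp.finsetSum_apply]
    exact (Finset.sum_pos' (fun i _ => hW i e) ⟨i, Finset.mem_univ _,
      lt_of_le_of_ne (hW i e) (Finsupp.mem_support_iff.1 he).symm⟩).ne'
  rw [chainCost_eq_sum subset_rfl, Finset.sum_congr rfl fun i _ => chainCost_eq_sum (hsub i),
    Finset.sum_comm]
  refine Finset.sum_congr rfl fun e he => ?_
  rw [Finsupp.mem_support_iff, Finsupp.finsetSum_apply] at he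
  obtain ⟨i, -, hi⟩ := Finset.exists_ne_zero_of_sum_ne_zero he
  have hz : ∀ i', i' ≠ i → W i' e = 0 := fun i' hne => by
    by_contra h'
    exact hne (hdis e i' i h' hi)
  rw [Finsupp.finsetSum_apply, Finset.sum_eq_single i (fun i' _ hne => hz i' hne) (by simp),
    Finset.sum_eq_single i (fun i' _ hne => by simp [hz i' hne]) (by simp)]

/-- Every arc of a forest flow is reached from a vertex with positive divergence. -/
lemma exists_chain_to_tail {W : V × V →₀ ℝ} (hW : 0 ≤ W) (hac : Acyclic W.support) {u v : V}
    (huv : Arc W u v) :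
    ∃ z ρ, 0 < div W z ∧ ρ.support ⊆ W.support ∧
      div ρ = Finsupp.single z 1 - Finsupp.single u 1 := by
  by_cases hin : ∃ w, Arc W w u
  · obtain ⟨w, hw⟩ := hin
    obtain ⟨z, hz, hz0⟩ := exists_root hac.not_transGen hw
    obtain ⟨w', hzw, -⟩ := Relation.TransGen.head'_iff.1 hz
    obtain ⟨ρ, -, -, hs, hdiv⟩ := exists_chain_of_transGen hz
    exact ⟨z, ρ, div_pos_of_noInflow hW hz0 hzw, hs, hdiv⟩
  · push Not at hin
    exact ⟨u, 0, div_pos_of_noInflow hW (fun w => not_not.1 (hin w)) huv, by simp, by simp⟩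

/-- A rigid edge set connects no point to two different sources. -/
lemma Rigid.source_unique {x : κ → V} (hxi : Function.Injective x) {F : Finset (V × V)}
    (hrig : Rigid x F) {u : V} {i i' : κ} {ρ ρ' : V × V →₀ ℝ} (hs : ρ.support ⊆ F)
    (hs' : ρ'.support ⊆ F) (hρ : div ρ = Finsupp.single (x i) 1 - Finsupp.single u 1)
    (hρ' : div ρ' = Finsupp.single (x i') 1 - Finsupp.single u 1) : i = i' := by
  classical
  by_contra hii
  have h0 := hrig (ρ - ρ') (Finsupp.support_sub.trans (Finset.union_subset hs hs')) fun v hv => by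
    have h1 : v ≠ x i := fun h => hv ⟨i, h.symm⟩
    have h2 : v ≠ x i' := fun h => hv ⟨i', h.symm⟩
    simp [hρ, hρ', h1, h2]
  have h1 := congrArg div h0
  rw [map_sub, hρ, hρ', map_zero] at h1
  have h2 := DFunLike.congr_fun h1 (x i)
  have h3 : x i ≠ x i' := fun h => hii (hxi h)
  simp [h3] at h2

end Sums

/-! ### Assignment maps and the splitting of a minimal flow -/

section Assignment

variable {V : Type*} {k l : ℕ}

/-- Summation against the plan of `S` picks the pairs `(S j, j)`. The row `planOfMap n S i` also
serves as the demand vector of the part of factory `i`. -/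
lemma sum_planOfMap_smul {M : Type*} [AddCommGroup M] [Module ℝ M] (n : Fin l → ℝ≥0)
    (S : Fin l → Fin k) (f : Fin k → Fin l → M) :
    ∑ i, ∑ j, (planOfMap n S i j : ℝ) • f i j = ∑ j, (n j : ℝ) • f (S j) j := by
  rw [Finset.sum_comm]
  refine Finset.sum_congr rfl fun j _ => ?_
  rw [Finset.sum_eq_single (S j)]
  · simp [planOfMap]
  · intro i _ hi; simp [planOfMap, hi]
  · simp

lemma planOfMap_mem (n : Fin l → ℝ≥0) (S : Fin l → Fin k) : planOfMap n S ∈ AllocPlan n := by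
  intro j; simp [planOfMap]

lemma sum_load_planOfMap (n : Fin l → ℝ≥0) (S : Fin l → Fin k)
    (τ : Fin k → Fin l → V × V →₀ ℝ) :
    ∑ i, load (planOfMap n S i) (τ i) = load n fun j => τ (S j) j :=
  sum_planOfMap_smul n S τ

lemma sum_single_planOfMap {A : Type*} (n : Fin l → ℝ≥0) (S : Fin l → Fin k)
    (f : Fin k → Fin l → A) :
    ∑ i, ∑ j, Finsupp.single (f i j) (planOfMap n S i j : ℝ) =
      ∑ j, Finsupp.single (f (S j) j) (n j : ℝ) := by
  simpa only [Finsupp.smul_single, smul_eq_mul, mul_one] using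
    sum_planOfMap_smul n S fun i j => Finsupp.single (f i j) (1 : ℝ)

lemma toReal_sourcePart (x : Fin k → V) (n : Fin l → ℝ≥0) (S : Fin l → Fin k) (i : Fin k) :
    toReal (sourcePart x n S i) = ∑ j, Finsupp.single (x i) (planOfMap n S i j : ℝ) := by
  rw [sourcePart, toReal_single, ← Finsupp.single_finsetSum, Finset.sum_filter]
  congr 1
  push_cast
  refine Finset.sum_congr rfl fun j _ => ?_
  simp [planOfMap, eq_comm]

lemma toReal_targetPart (y : Fin l → V) (n : Fin l → ℝ≥0) (S : Fin l → Fin k) (i : Fin k) :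
    toReal (targetPart y n S i) = demand y (planOfMap n S i) := by
  rw [targetPart, demand_eq_sum, toReal_sum, Finset.sum_filter]
  refine Finset.sum_congr rfl fun j _ => ?_
  by_cases h : S j = i
  · simp [planOfMap, h, toReal_single]
  · simp [planOfMap, h, Ne.symm h]

lemma sum_demand_planOfMap (y : Fin l → V) (n : Fin l → ℝ≥0) (S : Fin l → Fin k) :
    ∑ i, demand y (planOfMap n S i) = demand y n := by
  simp only [demand_eq_sum]
  exact sum_single_planOfMap n S fun _ j => y j

lemma toReal_atomic_production (x : Fin k → V) (q : Fin k → Fin l → ℝ≥0) :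
    toReal (atomic x (production q)) = ∑ i, ∑ j, Finsupp.single (x i) (q i j : ℝ) := by
  rw [atomic, toReal_sum]
  refine Finset.sum_congr rfl fun i _ => ?_
  rw [toReal_single, production, NNReal.coe_sum, Finsupp.single_finsetSum]

lemma toReal_atomic_production_planOfMap (x : Fin k → V) (n : Fin l → ℝ≥0) (S : Fin l → Fin k) :
    toReal (atomic x (production (planOfMap n S))) =
      ∑ j, Finsupp.single (x (S j)) (n j : ℝ) := by
  rw [toReal_atomic_production]
  exact sum_single_planOfMap n S fun i _ => x i

lemma sum_production {n : Fin l → ℝ≥0} {q : Fin k → Fin l → ℝ≥0} (hq : q ∈ AllocPlan n) :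
    ∑ i, production q i = ∑ j, n j := by
  unfold production
  rw [Finset.sum_comm]
  exact Finset.sum_congr rfl fun j _ => hq j

lemma atomic_eq_zero {x : Fin k → V} (m : Fin k → ℝ≥0) {v : V} (hv : v ∉ Set.range x) :
    atomic x m v = 0 := by
  rw [atomic, Finsupp.finsetSum_apply]
  exact Finset.sum_eq_zero fun i _ => Finsupp.single_eq_of_ne fun h => hv ⟨i, h.symm⟩

lemma mem_range_of_mem_support_atomic {x : Fin k → V} {m : Fin k → ℝ≥0} {v : V}
    (hv : v ∈ (atomic x m).support) : v ∈ Set.range x := by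
  by_contra h
  exact Finsupp.mem_support_iff.1 hv (atomic_eq_zero m h)

lemma sourcePart_eq_zero {x : Fin k → V} {n : Fin l → ℝ≥0} {S : Fin l → Fin k} {i : Fin k} {v : V}
    (hv : v ≠ x i) : sourcePart x n S i v = 0 :=
  Finsupp.single_eq_of_ne hv

/-- The part of a routing for `S` that starts at factory `i`. -/
lemma IsRouting.restrict {X : Set V} {x : Fin k → V} {y : Fin l → V} {n : Fin l → ℝ≥0}
    {S : Fin l → Fin k} {τ : Fin l → V × V →₀ ℝ} (h : IsRouting X n (x ∘ S) y τ) (i : Fin k) :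
    IsRouting X (planOfMap n S i) (fun _ => x i) y τ := by
  refine ⟨h.nonneg, h.mem, fun j hj => ?_⟩
  have hi : i = S j := by by_contra hne; simp [planOfMap, hne] at hj
  have hn : n j ≠ 0 := by simpa [planOfMap, hi] using hj
  rw [h.div_eq j hn, hi]; rfl

/-- Routings of the parts of all factories combine to a routing for `S`. -/
lemma IsRouting.glue {X : Set V} {x : Fin k → V} {y : Fin l → V} {n : Fin l → ℝ≥0}
    {S : Fin l → Fin k} {τ : Fin k → Fin l → V × V →₀ ℝ}
    (h : ∀ i, IsRouting X (planOfMap n S i) (fun _ => x i) y (τ i)) :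
    IsRouting X n (x ∘ S) y fun j => τ (S j) j :=
  ⟨fun j => (h _).nonneg j, fun j => (h _).mem j, fun j hj => (h (S j)).div_eq j
    (by simpa [planOfMap] using hj)⟩

lemma IsRouting.div_load_planOfMap {X : Set V} {x : Fin k → V} {y : Fin l → V} {n : Fin l → ℝ≥0}
    {S : Fin l → Fin k} {i : Fin k} {τ : Fin l → V × V →₀ ℝ}
    (h : IsRouting X (planOfMap n S i) (fun _ => x i) y τ) :
    div (load (planOfMap n S i) τ) =
      toReal (sourcePart x n S i) - toReal (targetPart y n S i) := by
  rw [h.div_load, toReal_sourcePart, toReal_targetPart, demand_eq_sum, Finset.sum_sub_distrib]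

lemma isFlow_sum_of_isTransportPath {X : Set V} {x : Fin k → V} {y : Fin l → V}
    {n : Fin l → ℝ≥0} {S : Fin l → Fin k} {Gs : Fin k → WeightedGraph V}
    (h : ∀ i, IsTransportPath X (sourcePart x n S i) (targetPart y n S i) (Gs i)) :
    IsFlow X x (demand y n) (toReal (WeightedGraph.sum Gs).weight) := by
  rw [toReal_weight_sum, ← sum_demand_planOfMap y n S]
  refine IsFlow.sum fun i => ?_
  rw [← toReal_targetPart]
  exact (h i).isFlow fun v hv => sourcePart_eq_zero fun h => hv ⟨i, h.symm⟩

variable [MetricSpace V]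

/-- The minimum `d_α(a_i, b_i)` is attained: apply the existence of minimal flows with `x i` as the
only factory. -/
theorem exists_isOptimalTransportPath {α : ℝ} (hα : 0 ≤ α) (hα1 : α < 1) {X : Set V}
    (hX : IsCompact X) {x : Fin k → V} (hx : ∀ i, x i ∈ X) {y : Fin l → V} (hy : ∀ j, y j ∈ X)
    (n : Fin l → ℝ≥0) (S : Fin l → Fin k) (i : Fin k) :
    ∃ G τ, IsOptimalTransportPath X α (sourcePart x n S i) (targetPart y n S i) G ∧
      IsRouting X (planOfMap n S i) (fun _ => x i) y τ ∧
      toReal G.weight = load (planOfMap n S i) τ := by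
  classical
  obtain ⟨S', τ, hτ, hmin⟩ := exists_isMinFlow hα hα1 hX (x := fun _ : Unit => x i) (fun _ => hx i)
    hy (planOfMap n S i)
  have hred := hmin.isReduced hα hα1 (demand_nonneg _ _)
  have hτ' : IsRouting X (planOfMap n S i) (fun _ => x i) y τ := hτ
  have ha : ∀ v ∈ (sourcePart x n S i).support, v ∈ X := fun v hv => by
    have : v = x i := by
      by_contra hne
      exact Finsupp.mem_support_iff.1 hv (sourcePart_eq_zero hne)
    exact this ▸ hx i
  have hb : ∀ v ∈ (targetPart y n S i).support, v ∈ X := fun v hv => by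
    have h0 := Finsupp.mem_support_iff.1 hv
    rw [targetPart, Finsupp.finsetSum_apply] at h0
    obtain ⟨j, -, hj⟩ := Finset.exists_ne_zero_of_sum_ne_zero h0
    have : v = y j := by
      by_contra hne
      exact hj (Finsupp.single_eq_of_ne hne)
    exact this ▸ hy j
  obtain ⟨G, hG, hGW⟩ := exists_transportPath hmin.1.nonneg hmin.1.mem ha hb
    hτ'.div_load_planOfMap hred.rigid.acyclic
  refine ⟨G, τ, ⟨hG, fun G' hG' => ?_⟩, hτ', hGW⟩
  rw [← NNReal.coe_le_coe, coe_cost, coe_cost, hGW]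
  refine hmin.2 _ ?_
  rw [← toReal_targetPart]
  exact hG'.isFlow fun v hv => sourcePart_eq_zero fun h => hv ⟨(), h.symm⟩

lemma dAlpha_eq {α : ℝ} {X : Set V} {a b : AtomicMeasure V} {G : WeightedGraph V}
    (h : IsOptimalTransportPath X α a b G) : dAlpha X α a b = (G.cost α : ℝ≥0∞) :=
  le_antisymm (iInf₂_le G h.1) (le_iInf₂ fun G' hG' => ENNReal.coe_le_coe.2 (h.2 G' hG'))

lemma mapCost_eq {α : ℝ} {X : Set V} {x : Fin k → V} {y : Fin l → V} {n : Fin l → ℝ≥0}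
    {S : Fin l → Fin k} {Gs : Fin k → WeightedGraph V}
    (h : ∀ i, IsOptimalTransportPath X α (sourcePart x n S i) (targetPart y n S i) (Gs i)) :
    mapCost X α x y n S = ((∑ i, (Gs i).cost α : ℝ≥0) : ℝ≥0∞) := by
  rw [mapCost, ENNReal.ofNNReal_finsetSum]
  exact Finset.sum_congr rfl fun i _ => dAlpha_eq (h i)

/-- A transport path with rigid support which is routed along `S` is the sum of transport paths for
the single factories. Different factories use disjoint sets of edges, so the costs add up. -/
theorem exists_split {α : ℝ} {X : Set V} {x : Fin k → V} (hk : 1 ≤ k)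
    (hxi : Function.Injective x) {y : Fin l → V} {n : Fin l → ℝ≥0} {S : Fin l → Fin k}
    {τ : Fin l → V × V →₀ ℝ} (hτ : IsRouting X n (x ∘ S) y τ) {a : AtomicMeasure V}
    {G : WeightedGraph V} (hG : IsTransportPath X a (atomic y n) G)
    (hGW : toReal G.weight = load n τ) (hrig : Rigid x (load n τ).support) :
    ∃ Gs : Fin k → WeightedGraph V,
      (∀ i, IsTransportPath X (sourcePart x n S i) (targetPart y n S i) (Gs i)) ∧
      G = WeightedGraph.sum Gs ∧ ∑ i, (Gs i).cost α = G.cost α := by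
  classical
  let W : Fin k → V × V →₀ ℝ := fun i => load (planOfMap n S i) τ
  have hW0 : ∀ i, 0 ≤ W i := fun i => load_nonneg hτ.nonneg
  have hsum : ∑ i, W i = load n τ := sum_load_planOfMap n S fun _ => τ
  have hne : ∀ i e, W i e ≠ 0 → load n τ e ≠ 0 := fun i e he => by
    rw [← hsum, Finsupp.finsetSum_apply]
    exact (Finset.sum_pos' (fun i _ => hW0 i e) ⟨i, Finset.mem_univ _,
      lt_of_le_of_ne (hW0 i e) (Ne.symm he)⟩).ne'
  have hsub : ∀ i, (W i).support ⊆ (load n τ).support := fun i e he =>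
    Finsupp.mem_support_iff.2 (hne i e (Finsupp.mem_support_iff.1 he))
  have hac : ∀ i, Acyclic (W i).support := fun i => hrig.acyclic.mono (hsub i)
  have hdiv : ∀ i, div (W i) = toReal (sourcePart x n S i) - toReal (targetPart y n S i) :=
    fun i => (hτ.restrict i).div_load_planOfMap
  choose Gs hverts hweight using fun i => exists_graph (hW0 i) G.verts fun e he =>
    G.mem_verts e (by
      rw [← support_toReal, Finsupp.mem_support_iff, hGW]; exact hne i e he)
  have hb : ∀ v, ∑ i, targetPart y n S i v = atomic y n v := fun v => by
    have h1 := DFunLike.congr_fun (sum_demand_planOfMap y n S) v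
    rw [Finset.sum_congr rfl fun i _ => (toReal_targetPart y n S i).symm,
      Finsupp.finsetSum_apply] at h1
    have h2 : ∑ i, (targetPart y n S i v : ℝ) = (atomic y n v : ℝ) := h1
    exact_mod_cast h2
  have ha : ∀ v, ∑ i, sourcePart x n S i v = a v := fun v => by
    have h1 := DFunLike.congr_fun hG.div_eq v
    rw [hGW, ← hsum, map_sum, Finsupp.finsetSum_apply, Finset.sum_congr rfl fun i _ => by
      rw [hdiv i, Finsupp.sub_apply, toReal_apply, toReal_apply], Finset.sum_sub_distrib,
      Finsupp.sub_apply, toReal_apply, toReal_apply, ← hb v, NNReal.coe_sum, sub_left_inj] at h1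
    exact_mod_cast h1
  refine ⟨Gs, fun i => .of_div_eq (fun v hv => hG.verts_subset v (hverts i ▸ hv))
    (fun v hv => ?_) (fun v hv => ?_) (by rw [hweight, hdiv]) (by rw [hweight]; exact hac i),
    WeightedGraph.ext ?_ (toReal_injective ?_), ?_⟩
  · rw [hverts]
    refine hG.source_mem v ?_
    rw [Finsupp.mem_support_iff, ← ha v]
    exact fun h0 => Finsupp.mem_support_iff.1 hv (Finset.sum_eq_zero_iff.1 h0 i (Finset.mem_univ _))
  · rw [hverts]
    refine hG.target_mem v ?_
    rw [Finsupp.mem_support_iff, ← hb v]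
    exact fun h0 => Finsupp.mem_support_iff.1 hv (Finset.sum_eq_zero_iff.1 h0 i (Finset.mem_univ _))
  · ext v
    simp only [WeightedGraph.sum, Finset.mem_biUnion, Finset.mem_univ, true_and, hverts]
    exact ⟨fun h => ⟨⟨0, hk⟩, h⟩, fun ⟨_, h⟩ => h⟩
  · rw [toReal_weight_sum, hGW, ← hsum]
    exact (Finset.sum_congr rfl fun i _ => hweight i).symm
  · apply NNReal.coe_injective
    rw [NNReal.coe_sum, coe_cost, hGW, ← hsum]
    simp only [coe_cost, hweight]
    refine (chainCost_sum_of_disjoint hW0 fun e i i' hi hi' => ?_).symm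
    -- An arc used by two factories would connect them inside the support.
    have hconn : ∀ i, W i e ≠ 0 → ∃ ρ : V × V →₀ ℝ, ρ.support ⊆ (load n τ).support ∧
        div ρ = Finsupp.single (x i) 1 - Finsupp.single e.1 1 := by
      intro i hi
      obtain ⟨z, ρ, hz, hs, hρ⟩ := exists_chain_to_tail (hW0 i) (hac i) (u := e.1) (v := e.2) hi
      have : z = x i := by
        by_contra hne
        rw [hdiv i, Finsupp.sub_apply, toReal_apply, toReal_apply, sourcePart_eq_zero hne] at hz
        have := (targetPart y n S i z).2
        simp only [NNReal.coe_zero, NNReal.val_eq_coe] at hz this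
        linarith
      subst this
      exact ⟨ρ, hs.trans (hsub i), hρ⟩
    obtain ⟨ρ, hs, hρ⟩ := hconn i hi
    obtain ⟨ρ', hs', hρ'⟩ := hconn i' hi'
    exact hrig.source_unique hxi hs hs' hρ hρ'

end Assignment

/-! ### Compatible paths and optimal splittings -/

section Optimality

variable {V : Type*} {k l : ℕ} {X : Set V} {x : Fin k → V} {y : Fin l → V} {n : Fin l → ℝ≥0}
  {S : Fin l → Fin k} {τ : Fin l → V × V →₀ ℝ}

lemma mem_support_atomic (hn : ∀ j, 0 < n j) (j : Fin l) : y j ∈ (atomic y n).support := by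
  have h := demand_pos y (hn j).ne'
  rw [Finsupp.mem_support_iff]
  intro h0
  rw [demand, toReal_apply, h0] at h
  simp at h

lemma exists_transportPath_of_routing (hx : ∀ i, x i ∈ X) (hy : ∀ j, y j ∈ X)
    (hτ : IsRouting X n (x ∘ S) y τ) (hac : Acyclic (load n τ).support) :
    ∃ G, IsTransportPath X (atomic x (production (planOfMap n S))) (atomic y n) G ∧
      toReal G.weight = load n τ := by
  refine exists_transportPath (load_nonneg hτ.nonneg) (fun e he => ?_) (fun v hv => ?_)
    (fun v hv => ?_) ?_ hac
  · obtain ⟨j, -, hj⟩ := exists_ne_zero_of_load e he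
    exact hτ.mem j e hj
  · obtain ⟨i, rfl⟩ := mem_range_of_mem_support_atomic hv
    exact hx i
  · obtain ⟨j, rfl⟩ := mem_range_of_mem_support_atomic hv
    exact hy j
  · rw [hτ.div_load, toReal_atomic_production_planOfMap, Finset.sum_sub_distrib,
      show toReal (atomic y n) = demand y n from rfl, demand_eq_sum]
    rfl

/-- A flow with rigid support which is routed along `S` is a transport path compatible with the plan
of `S`. -/
theorem exists_compatible (hn : ∀ j, 0 < n j) (hx : ∀ i, x i ∈ X)
    (hxi : Function.Injective x) (hy : ∀ j, y j ∈ X) (hτ : IsRouting X n (x ∘ S) y τ)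
    (hflow : IsFlow X x (demand y n) (load n τ)) (hrig : Rigid x (load n τ).support) :
    ∃ G, IsTransportPath X (atomic x (production (planOfMap n S))) (atomic y n) G ∧
      Compatible x y G (planOfMap n S) ∧ toReal G.weight = load n τ := by
  classical
  obtain ⟨G, hG, hGW⟩ := exists_transportPath_of_routing hx hy hτ hrig.acyclic
  refine ⟨G, hG, ?_, hGW⟩
  rcases isEmpty_or_nonempty (Fin k) with hk | hk
  · exact ⟨fun i => hk.elim i, fun i => hk.elim i, fun i => hk.elim i, toReal_injective (by
      rw [hGW, load]
      simp [Finset.univ_eq_empty_iff.2 (⟨fun j => hk.elim (S j)⟩ : IsEmpty (Fin l))])⟩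
  obtain ⟨S', g, hg, hW⟩ := hflow.exists_curves hrig
  have hne : ∀ j, n j ≠ 0 := fun j => (hn j).ne'
  have hsub : ∀ j, (toReal (curveChain (g j))).support ⊆ (load n τ).support := fun j e he =>
    Finsupp.mem_support_iff.2 (rel_of_curveChain_ne_zero (hg j (hne j)).2.2.2
      (by rw [support_toReal] at he; exact Finsupp.mem_support_iff.1 he))
  obtain rfl : S = S' := funext fun j =>
    hrig.source_unique hxi (support_subset_load hτ.nonneg (hne j)) (hsub j)
      (hτ.div_eq j (hne j))
      (div_curveChain (hg j (hne j)).1 (hg j (hne j)).2.1 (hg j (hne j)).2.2.1)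
  have hcurve : ∀ j, G.IsCurve (x (S j)) (y j) (g j) := fun j => by
    obtain ⟨h1, h2, h3, h4⟩ := hg j (hne j)
    rw [← hGW] at h4
    exact ⟨h1, h2, h3, mem_verts_of_isChain h4 h2 (hG.target_mem _ (mem_support_atomic hn j)),
      h4.imp fun a b hab => arc_toReal_iff.1 hab⟩
  have hother : ∀ i j, ∃ p, G.IsCurveOrEmpty (x i) (y j) p := fun i j => by
    by_cases h : ∃ p, G.IsCurve (x i) (y j) p
    · exact ⟨h.choose, Or.inl h.choose_spec⟩
    · exact ⟨[], Or.inr ⟨rfl, h⟩⟩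
  choose p hp using hother
  refine ⟨fun i j => if i = S j then g j else p i j, fun i j => ?_, fun i j hij => ?_,
    toReal_injective ?_⟩
  · by_cases h : i = S j
    · subst h; simp only [if_true]; exact Or.inl (hcurve j)
    · simpa [h] using hp i j
  · by_cases h : i = S j
    · subst h
      have := (hcurve j).1
      simp only [if_true] at hij
      simp [hij] at this
    · simp [planOfMap, h]
  · rw [hGW, hW]
    simp only [toReal_sum, toReal_smul]
    rw [sum_planOfMap_smul n S]
    simp

lemma Compatible.exists_forestRouting {a b : AtomicMeasure V} {G : WeightedGraph V}
    {q : Fin k → Fin l → ℝ≥0} (hG : IsTransportPath X a b G) (h : Compatible x y G q) :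
    ∃ τ, IsForestRouting X (fun c : Fin k × Fin l => q c.1 c.2) (fun c => x c.1) (fun c => y c.2)
      τ ∧ load (fun c : Fin k × Fin l => q c.1 c.2) τ = toReal G.weight := by
  obtain ⟨g, hg, hg0, hW⟩ := h
  have hflow := hG.isFlow (x := fun v : V => v) fun v hv => absurd ⟨v, rfl⟩ hv
  refine exists_forestRouting_of_curves hflow.mem hG.acyclic (g := fun c => g c.1 c.2)
    (fun c hc => ?_) ?_
  · rcases hg c.1 c.2 with h | h
    · exact ⟨h.1, h.2.1, h.2.2.1, h.2.2.2.2.imp fun a b hab => arc_toReal_iff.2 hab⟩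
    · exact absurd (hg0 _ _ h.1) hc
  · rw [hW, Fintype.sum_prod_type]
    simp only [toReal_sum, toReal_smul]

lemma eq_planOfMap {q : Fin k → Fin l → ℝ≥0} (hq : q ∈ AllocPlan n)
    (h : ∀ i j, i ≠ S j → q i j = 0) : q = planOfMap n S := by
  funext i j
  by_cases hi : i = S j
  · subst hi
    have h1 := hq j
    rw [Finset.sum_eq_single (S j) (fun i _ hi => h i j hi) (by simp)] at h1
    simpa [planOfMap] using h1
  · simp [planOfMap, hi, h i j hi]

variable [MetricSpace V] {α : ℝ}

/-- A minimal flow which is routed along `S` is the sum of optimal transport paths for the single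
factories, so its cost is `E_α(S)`. -/
theorem IsMinFlow.exists_optimal_split (hα : 0 ≤ α) (hα1 : α < 1) (hX : IsCompact X)
    (hk : 1 ≤ k) (hx : ∀ i, x i ∈ X) (hxi : Function.Injective x) (hy : ∀ j, y j ∈ X)
    (hmin : IsMinFlow α X x (demand y n) (load n τ)) (hτ : IsRouting X n (x ∘ S) y τ)
    {a : AtomicMeasure V} {G : WeightedGraph V} (hG : IsTransportPath X a (atomic y n) G)
    (hGW : toReal G.weight = load n τ) :
    IsPathOfMap X α x y n S G ∧ mapCost X α x y n S = (G.cost α : ℝ≥0∞) := by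
  obtain ⟨Gs, hGs, hsum, hcost⟩ := exists_split (α := α) hk hxi hτ hG hGW
    (hmin.isReduced hα hα1 (demand_nonneg y n)).rigid
  choose Hs _ hHs _ _ using exists_isOptimalTransportPath hα hα1 hX hx hy n S
  have hle : ∀ i ∈ Finset.univ, (Hs i).cost α ≤ (Gs i).cost α := fun i _ => (hHs i).2 _ (hGs i)
  have hge : G.cost α ≤ ∑ i, (Hs i).cost α := by
    refine le_trans ?_ (coe_cost_sum_le hα hα1 Hs)
    rw [← NNReal.coe_le_coe, coe_cost, coe_cost, hGW]
    exact hmin.2 _ (isFlow_sum_of_isTransportPath fun i => (hHs i).1)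
  have heq : ∑ i, (Hs i).cost α = ∑ i, (Gs i).cost α :=
    le_antisymm (Finset.sum_le_sum hle) (hcost ▸ hge)
  have hpt := (Finset.sum_eq_sum_iff_of_le hle).1 heq
  refine ⟨⟨Gs, fun i => ⟨hGs i, fun G' hG' => ?_⟩, hsum⟩, ?_⟩
  · rw [← hpt i (Finset.mem_univ i)]
    exact (hHs i).2 G' hG'
  · rw [mapCost_eq hHs, heq, hcost]

end Optimality

end RamifiedAllocation

theorem theorem1 {m k l : ℕ} (X : Set (EuclideanSpace ℝ (Fin m)))
    (hXcompact : IsCompact X) (hXconvex : Convex ℝ X)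
    (hk : 1 ≤ k) (x : Fin k → EuclideanSpace ℝ (Fin m)) (hx : ∀ i, x i ∈ X)
    (hx_inj : Function.Injective x)
    (y : Fin l → EuclideanSpace ℝ (Fin m)) (hy : ∀ j, y j ∈ X)
    (n : Fin l → ℝ≥0) (hn_pos : ∀ j, 0 < n j) (hn_sum : ∑ j, n j = 1)
    (α : ℝ) (hα_nonneg : 0 ≤ α) (hα_lt : α < 1) :
    (∀ q ∈ AllocPlan (k := k) n,
      IsOptimalPlan X α x y n q ↔
        ∃ S : Fin l → Fin k, IsOptimalMap X α x y n S ∧ q = planOfMap n S) ∧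
    (∀ G ∈ AllocPath X x y n,
      IsOptimalPath X α x y n G ↔
        ∃ S : Fin l → Fin k, IsOptimalMap X α x y n S ∧ IsPathOfMap X α x y n S G) ∧
    (∃ c : ℝ≥0,
      IsLeast (planCost X α x y n '' AllocPlan (k := k) n) c ∧
      IsLeast (Set.range (mapCost X α x y n : (Fin l → Fin k) → ℝ≥0∞)) c ∧
      IsLeast (WeightedGraph.cost α '' AllocPath X x y n) c) := by
  classical
  have : Nonempty (Fin k) := ⟨⟨0, hk⟩⟩
  obtain ⟨S₀, τ₀, hτ₀, hmin₀⟩ := exists_isMinFlow hα_nonneg hα_lt hXcompact hx hy n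
  obtain ⟨G₀, hG₀, hGW₀⟩ := exists_transportPath_of_routing hx hy hτ₀
    (hmin₀.isReduced hα_nonneg hα_lt (demand_nonneg y n)).rigid.acyclic
  obtain ⟨c, hc⟩ : ∃ c : ℝ≥0, c = G₀.cost α := ⟨_, rfl⟩
  have hcR : (c : ℝ) = chainCost α edgeLength (load n τ₀) := by rw [hc, coe_cost, hGW₀]
  have hprod : ∀ q ∈ AllocPlan (k := k) n, ∑ i, production q i = 1 := fun q hq =>
    (sum_production hq).trans hn_sum
  have hflowG : ∀ (p : Fin k → ℝ≥0) G, IsTransportPath X (atomic x p) (atomic y n) G →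
      IsFlow X x (demand y n) (toReal G.weight) := fun p G hG =>
    hG.isFlow fun v hv => atomic_eq_zero p hv
  -- Lower bounds: every allocation path, plan and assignment map costs at least `c`.
  have hlow : ∀ G : WeightedGraph (EuclideanSpace ℝ (Fin m)),
      IsFlow X x (demand y n) (toReal G.weight) → c ≤ G.cost α := fun G hG => by
    rw [← NNReal.coe_le_coe, coe_cost, hcR]
    exact hmin₀.2 _ hG
  have hminOf : ∀ W, IsFlow X x (demand y n) W → chainCost α edgeLength W ≤ c →
      IsMinFlow α X x (demand y n) W := fun W hW hle =>
    ⟨hW, fun W' hW' => hle.trans (hcR ▸ hmin₀.2 W' hW')⟩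
  have hplanlow : ∀ q ∈ AllocPlan (k := k) n, (c : ℝ≥0∞) ≤ planCost X α x y n q := fun q hq =>
    le_iInf₂ fun G hG => ENNReal.coe_le_coe.2 (hlow G (hflowG _ G hG.1))
  choose Hs σ hHs hσ hHW using fun S : Fin l → Fin k =>
    exists_isOptimalTransportPath hα_nonneg hα_lt hXcompact hx hy n S
  have hmapsum : ∀ S, ((WeightedGraph.sum (Hs S)).cost α : ℝ≥0∞) ≤ mapCost X α x y n S := by
    intro S
    rw [mapCost_eq (hHs S)]
    exact ENNReal.coe_le_coe.2 (coe_cost_sum_le hα_nonneg hα_lt _)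
  have hsumflow : ∀ S, IsFlow X x (demand y n) (toReal (WeightedGraph.sum (Hs S)).weight) :=
    fun S => isFlow_sum_of_isTransportPath fun i => (hHs S i).1
  have hmaplow : ∀ S, (c : ℝ≥0∞) ≤ mapCost X α x y n S := fun S =>
    (ENNReal.coe_le_coe.2 (hlow _ (hsumflow S))).trans (hmapsum S)
  have hmap₀ : mapCost X α x y n S₀ = c := hc ▸
    (hmin₀.exists_optimal_split hα_nonneg hα_lt hXcompact hk hx hx_inj hy hτ₀ hG₀ hGW₀).2
  have hmapopt : ∀ S, IsOptimalMap X α x y n S ↔ mapCost X α x y n S = c := fun S =>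
    ⟨fun h => le_antisymm (hmap₀ ▸ h S₀) (hmaplow S), fun h S' => h ▸ hmaplow S'⟩
  -- For an optimal `S`, the sum of optimal paths is a minimal flow, so it is a forest and hence
  -- compatible with the plan of `S`.
  have hplanopt : ∀ S, mapCost X α x y n S = c → planCost X α x y n (planOfMap n S) = c := by
    intro S hS
    have hW : toReal (WeightedGraph.sum (Hs S)).weight = load n fun j => σ S (S j) j := by
      rw [toReal_weight_sum, ← sum_load_planOfMap n S (σ S)]
      exact Finset.sum_congr rfl fun i _ => hHW S i
    have hle : (WeightedGraph.sum (Hs S)).cost α ≤ c := by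
      have := hmapsum S
      rw [hS] at this
      exact ENNReal.coe_le_coe.1 this
    have hle' : chainCost α edgeLength (load n fun j => σ S (S j) j) ≤ c := by
      rw [← hW, ← coe_cost]; exact hle
    have hfl : IsFlow X x (demand y n) (load n fun j => σ S (S j) j) := hW ▸ hsumflow S
    obtain ⟨G, hG, hcomp, hGW⟩ := exists_compatible hn_pos hx hx_inj hy (IsRouting.glue (hσ S)) hfl
      ((hminOf _ hfl hle').isReduced hα_nonneg hα_lt (demand_nonneg y n)).rigid
    refine le_antisymm ((iInf₂_le G ⟨hG, hcomp⟩).trans (ENNReal.coe_le_coe.2 ?_))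
      (hplanlow _ (planOfMap_mem n S))
    rw [← NNReal.coe_le_coe, coe_cost, hGW]
    exact hle'
  have hplan₀ := hplanopt S₀ hmap₀
  have hpath₀ : G₀ ∈ AllocPath X x y n := ⟨_, hprod _ (planOfMap_mem n S₀), hG₀⟩
  refine ⟨fun q hq => ⟨fun hopt => ?_, ?_⟩, fun G hG => ⟨fun hopt => ?_, ?_⟩, c,
    ⟨⟨_, planOfMap_mem n S₀, hplan₀⟩, ?_⟩, ⟨⟨S₀, hmap₀⟩, ?_⟩, ⟨⟨G₀, hpath₀, hc.symm⟩, ?_⟩⟩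
  -- The infimum `planCost q` is not known to be attained, but some flow carries `q` and costs at
  -- most `planCost q`.
  · have hqc : planCost X α x y n q ≤ c := hplan₀ ▸ hopt.2 _ (planOfMap_mem n S₀)
    obtain ⟨τ, hτ, hloop, hτmin⟩ := exists_optimal_routing hXcompact ⟨_, hx ⟨0, hk⟩⟩ hα_nonneg
      hα_lt (fun c : Fin k × Fin l => q c.1 c.2) (src := fun c => x c.1) (tgt := fun c => y c.2)
      (fun c => hx _) fun c => hy _
    set W := load (fun c : Fin k × Fin l => q c.1 c.2) τ with hW
    have hfl : IsFlow X x (demand y n) W := by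
      refine hτ.isFlow hloop (fun c => ⟨c.1, rfl⟩) ?_
      rw [demand_eq_sum, Fintype.sum_prod_type, Finset.sum_comm]
      refine Finset.sum_congr rfl fun j _ => ?_
      change _ = ∑ i, Finsupp.single (y j) (q i j : ℝ)
      rw [← Finsupp.single_finsetSum, ← NNReal.coe_sum, hq j]
    have hle : chainCost α edgeLength W ≤ c := by
      have h0 : 0 ≤ chainCost α edgeLength W := chainCost_nonneg edgeLength_nonneg hfl.nonneg
      let r : ℝ≥0 := ⟨chainCost α edgeLength W, h0⟩
      have h1 : (r : ℝ≥0∞) ≤ planCost X α x y n q := by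
        refine le_iInf₂ fun G hG => ENNReal.coe_le_coe.2 ?_
        obtain ⟨τ', hτ', hload⟩ := hG.2.exists_forestRouting hG.1
        rw [← NNReal.coe_le_coe, coe_cost, ← hload]
        exact hτmin τ' hτ'
      exact NNReal.coe_le_coe.2 (ENNReal.coe_le_coe.1 (h1.trans hqc))
    have hmin := hminOf W hfl hle
    have hrig := (hmin.isReduced hα_nonneg hα_lt (demand_nonneg y n)).rigid
    -- Two factories which serve the same household would be connected in the support of `W`.
    have huniq : ∀ i i' j, q i j ≠ 0 → q i' j ≠ 0 → i = i' := fun i i' j hi hi' =>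
      hrig.source_unique hx_inj
        (support_subset_load hτ.nonneg (c := (i, j)) hi)
        (support_subset_load hτ.nonneg (c := (i', j)) hi')
        (hτ.div_eq (i, j) hi) (hτ.div_eq (i', j) hi')
    have hex : ∀ j, ∃ i, q i j ≠ 0 := fun j => by
      have h := (hn_pos j).ne'
      rw [← hq j] at h
      obtain ⟨i, -, hi⟩ := Finset.exists_ne_zero_of_sum_ne_zero h
      exact ⟨i, hi⟩
    choose S hS using hex
    obtain rfl : q = planOfMap n S := eq_planOfMap hq fun i j hij => by
      by_contra hne
      exact hij (huniq i (S j) j hne (hS j))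
    refine ⟨S, (hmapopt S).2 ?_, rfl⟩
    have hWS : W = load n fun j => τ (S j, j) := by
      rw [hW, load, Fintype.sum_prod_type]
      exact sum_planOfMap_smul n S fun i j => τ (i, j)
    have hτS : IsRouting X n (x ∘ S) y fun j => τ (S j, j) :=
      ⟨fun j => hτ.nonneg _, fun j => hτ.mem _, fun j _ => hτ.div_eq (S j, j) (hS j)⟩
    rw [hWS] at hmin hrig hle
    obtain ⟨G, hG, hGW⟩ := exists_transportPath_of_routing hx hy hτS hrig.acyclic
    refine le_antisymm ?_ (hmaplow S)
    rw [(hmin.exists_optimal_split hα_nonneg hα_lt hXcompact hk hx hx_inj hy hτS hG hGW).2]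
    refine ENNReal.coe_le_coe.2 ?_
    rw [← NNReal.coe_le_coe, coe_cost, hGW]
    exact hle
  · rintro ⟨S, hS, rfl⟩
    refine ⟨hq, fun q' hq' => ?_⟩
    rw [hplanopt S ((hmapopt S).1 hS)]
    exact hplanlow q' hq'
  · obtain ⟨p, -, hG'⟩ := hG
    have hGc : G.cost α = c := le_antisymm (hc ▸ hopt.2 G₀ hpath₀) (hlow G (hflowG p G hG'))
    have hfl := hflowG p G hG'
    have hmin := hminOf _ hfl (by rw [← coe_cost, hGc])
    have hred := hmin.isReduced hα_nonneg hα_lt (demand_nonneg y n)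
    obtain ⟨S, g, hg, hW⟩ := hfl.exists_curves hred.rigid
    obtain ⟨τ, hτ, hload⟩ := exists_forestRouting_of_curves (src := x ∘ S) hfl.mem
      hred.rigid.acyclic hg hW
    rw [← hload] at hmin
    obtain ⟨h1, h2⟩ := hmin.exists_optimal_split hα_nonneg hα_lt hXcompact hk hx hx_inj hy
      hτ.toIsRouting hG' hload.symm
    exact ⟨S, (hmapopt S).2 (by rw [h2, hGc]), h1⟩
  · rintro ⟨S, hS, Gs, hGs, rfl⟩
    refine ⟨hG, fun G' hG' => ?_⟩
    obtain ⟨p, -, hG'⟩ := hG'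
    have h1 := (hmapopt S).1 hS
    rw [mapCost_eq hGs] at h1
    exact ((coe_cost_sum_le hα_nonneg hα_lt Gs).trans (ENNReal.coe_injective h1).le).trans
      (hlow G' (hflowG p G' hG'))
  · rintro _ ⟨q, hq, rfl⟩; exact hplanlow q hq
  · rintro _ ⟨S, rfl⟩; exact hmaplow S
  · rintro _ ⟨G, ⟨p, -, hG⟩, rfl⟩; exact hlow G (hflowG p G hG)
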